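/- Let $d\ge 1$, $T>0$, $1/3<\gamma\le 1/2$, and let $u_0\in L^\infty(\mathbb R^d)$. Let $b:[0,T]\times\mathbb R^d\to\mathbb R^d$ be measurable with at most linear growth, i.e. $b\in L^\infty([0,T];\mathrm{Lin}(\mathbb R^d))$: $\operatorname{ess\,sup}_{t,x}|b_t(x)|/(1+|x|)<\infty$, and assume that the distributional divergence (in $x$) satisfies $\operatorname{div} b\in L^\infty([0,T]\times\mathbb R^d)$. Let $\mathbf X=(X,\mathbb X)$ be a geometric $\gamma$-rough path on $[0,T]$ with values in $\mathbb R^d$, that is: $X\in\mathcal C^\gamma([0,T];\mathbb R^d)$; $\mathbb X:[0,T]^2\to\mathbb R^{d\times d}$ is continuous, vanishes on the diagonal and satisfies $\|\mathbb X\|_{2\gamma}:=\sup_{s\ne t}|\mathbb X_{s,t}|/|t-s|^{2\gamma}<\infty$; $\mathbb X^{ij}_{s,t}-\mathbb X^{ij}_{s,r}-\mathbb X^{ij}_{r,t}=(X^i_r-X^i_s)(X^j_t-X^j_r)$ for $s\le r\le t$; and there are paths $X^n\in C^1([0,T];\mathbb R^d)$ with $\|X-X^n\|_{\gamma}+\|\mathbb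 X-\mathbb X^n\|_{2\gamma}\to0$, where $\mathbb X^n_{s,t}=\int_s^t(X^n_r-X^n_s)\otimes\dot X^n_r\,dr$ and $\|f\|_\gamma=|f_0|+\sup_{s\neq t}|f_t-f_s|/|t-s|^\gamma$. Then the rough transport equation $$\partial_t u_t(x)+b_t(x)\cdot\nabla u_t(x)+\nabla u_t(x)\cdot d\mathbf X_t=0,\qquad u|_{t=0}=u_0,$$ has a weak controlled solution $u\in L^\infty([0,T]\times\mathbb R^d)$. That is, $u$ has a representative with $u_t\in L^\infty(\mathbb R^d)$ for every $t\in[0,T]$ such that, writing $u_t(\varphi)=\int_{\mathbb R^d}u_t(x)\varphi(x)\,dx$, for every $\varphi\in C_c^\infty(\mathbb R^d)$: 1. the path $t\mapsto u_t(\varphi)$ is $\gamma$-controlled by $X$ with derivative $u(\nabla\varphi)$: the paths $u(\varphi)$ and $u(\nabla\varphi)$ belong to $\mathcal C^\gamma([0,T])$, and the remainder $(s,t)\mapsto u_t(\varphi)-u_s(\varphi)-u_s(\nabla\varphi)\cdot(X_t-X_s)$ is continuous on $[0,T]^2$ and bounded by $C_\varphi|t-s|^{2\gamma}$; 2. for every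 $t\in[0,T]$, $$u_t(\varphi)=\int_{\mathbb R^d} u_0\varphi\,dx+\int_0^t u_s\big(b_s\cdot\nabla\varphi+(\operatorname{div}b_s)\,\varphi\big)\,ds+\int_0^t u_s(\nabla\varphi)\cdot d\mathbf X_s ,$$ where the last term is the controlled rough integral of $u(\nabla\varphi)$ with derivative $u(\nabla^2\varphi)$, i.e. the limit, which exists, of the sums $$\sum_{k}\Big(u_{t_k}(\nabla\varphi)\cdot(X_{t_{k+1}}-X_{t_k})+\sum_{i,j=1}^d u_{t_k}(\partial_j\partial_i\varphi)\,\mathbb X^{ji}_{t_k,t_{k+1}}\Big)$$ over partitions $0=t_0\le\dots\le t_n=t$ as the mesh tends to $0$. -/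

import Mathlib

open MeasureTheory Filter Topology
open scoped ENNReal ContDiff

noncomputable section

namespace RoughTransport

/-! ### Hölder spaces on `[0,T]` -/

section Holder

variable {F : Type*} [NormedAddCommGroup F]

/-- The Hölder seminorm `sup_{s ≠ t} ‖f t - f s‖ / |t - s| ^ α` over `s, t ∈ [0,T]`,
with values in `[0,∞]`. -/
def holderSeminorm (α T : ℝ) (f : ℝ → F) : ℝ≥0∞ :=
  ⨆ (s ∈ Set.Icc (0 : ℝ) T) (t ∈ Set.Icc (0 : ℝ) T) (_ : s ≠ t),
    ‖f t - f s‖ₑ / ENNReal.ofReal (|t - s| ^ α)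

/-- The norm `‖f 0‖ + [f]_α` of the Hölder space `C^α([0,T]; F)`. -/
def holderNorm (α T : ℝ) (f : ℝ → F) : ℝ≥0∞ :=
  ‖f 0‖ₑ + holderSeminorm α T f

/-- `f ∈ C^α([0,T]; F)` for `0 < α ≤ 1`. -/
def IsHolder (α T : ℝ) (f : ℝ → F) : Prop :=
  ContinuousOn f (Set.Icc 0 T) ∧ holderSeminorm α T f < ⊤

/-- The norm `sup_{s ≠ t} ‖f s t‖ / |t - s| ^ ν` over `s, t ∈ [0,T]`, with values in `[0,∞]`. -/
def holderNorm₂ (ν T : ℝ) (f : ℝ → ℝ → F) : ℝ≥0∞ :=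
  ⨆ (s ∈ Set.Icc (0 : ℝ) T) (t ∈ Set.Icc (0 : ℝ) T) (_ : s ≠ t),
    ‖f s t‖ₑ / ENNReal.ofReal (|t - s| ^ ν)

/-- `f ∈ C_2^ν([0,T]²; F)`: `f` is continuous on `[0,T]²`, vanishes on the diagonal and has
finite norm. -/
structure IsHolder₂ (ν T : ℝ) (f : ℝ → ℝ → F) : Prop where
  continuousOn : ContinuousOn (fun p : ℝ × ℝ => f p.1 p.2) (Set.Icc 0 T ×ˢ Set.Icc 0 T)
  diag : ∀ t ∈ Set.Icc (0 : ℝ) T, f t t = 0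
  norm_lt_top : holderNorm₂ ν T f < ⊤

end Holder

variable {d : ℕ}

/-! ### Rough paths and controlled paths -/

/-- `(X, XX)` is a rough path of order `γ` on `[0,T]`; here `XX s t i j` is the `(i,j)` entry of
the second level, formally `∫_s^t (X^i_r - X^i_s) dX^j_r`. -/
structure IsRoughPath (γ T : ℝ) (X : ℝ → EuclideanSpace ℝ (Fin d))
    (XX : ℝ → ℝ → Fin d → Fin d → ℝ) : Prop where
  holder : IsHolder γ T X
  holder₂ : IsHolder₂ (2 * γ) T XX
  chen : ∀ s u t : ℝ, 0 ≤ s → s ≤ u → u ≤ t → t ≤ T → ∀ i j : Fin d,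
    XX s t i j - XX s u i j - XX u t i j = (X u i - X s i) * (X t j - X u j)

/-- The second level `∫_s^t (Y_r - Y_s) ⊗ Y'_r dr` of the natural lift of a `C¹` path on
`[0,T]`. -/
def naturalLift (T : ℝ) (Y : ℝ → EuclideanSpace ℝ (Fin d)) (s t : ℝ) (i j : Fin d) : ℝ :=
  ∫ r in s..t, (Y r i - Y s i) * derivWithin Y (Set.Icc 0 T) r j

/-- The rough path distance `‖X - Y‖_γ + ‖XX - YY‖_{2γ}`. -/
def roughDist (γ T : ℝ) (X : ℝ → EuclideanSpace ℝ (Fin d)) (XX : ℝ → ℝ → Fin d → Fin d → ℝ)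
    (Y : ℝ → EuclideanSpace ℝ (Fin d)) (YY : ℝ → ℝ → Fin d → Fin d → ℝ) : ℝ≥0∞ :=
  holderNorm γ T (fun t => X t - Y t) + holderNorm₂ (2 * γ) T (fun s t => XX s t - YY s t)

/-- `(X, XX)` is a geometric `γ`-rough path on `[0,T]`: a rough path which is a limit of natural
lifts of `C¹` paths for the rough path distance. -/
structure IsGeometricRoughPath (γ T : ℝ) (X : ℝ → EuclideanSpace ℝ (Fin d))
    (XX : ℝ → ℝ → Fin d → Fin d → ℝ) : Prop where
  isRoughPath : IsRoughPath γ T X XX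
  approx : ∃ Y : ℕ → ℝ → EuclideanSpace ℝ (Fin d),
    (∀ n, ContDiffOn ℝ 1 (Y n) (Set.Icc 0 T)) ∧
      Tendsto (fun n => roughDist γ T X XX (Y n) (naturalLift T (Y n))) atTop (𝓝 0)

/-- The real path `y` is `γ`-controlled by `X` on `[0,T]` with derivative `y'`:
`y_t - y_s = y'_s · (X_t - X_s) + y#_{s,t}` with `y, y' ∈ C^γ` and `y# ∈ C_2^{2γ}`. -/
structure IsControlled (γ T : ℝ) (X : ℝ → EuclideanSpace ℝ (Fin d))
    (y : ℝ → ℝ) (y' : ℝ → EuclideanSpace ℝ (Fin d)) : Prop where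
  holder : IsHolder γ T y
  holder_deriv : IsHolder γ T y'
  holder_remainder :
    IsHolder₂ (2 * γ) T (fun s t => y t - y s - ∑ i, y' s i * (X t i - X s i))

/-- The Riemann sum
`∑_k (∑_i a^i_{τ_k} (X^i_{τ_{k+1}} - X^i_{τ_k}) + ∑_{i,j} (a^i)'^j_{τ_k} XX^{j,i}_{τ_k,τ_{k+1}})`
of the path `a` with values in `ℝ^d`, where `a' t i` is the derivative of the component `a^i`
as a controlled path. -/
def roughSum (X : ℝ → EuclideanSpace ℝ (Fin d)) (XX : ℝ → ℝ → Fin d → Fin d → ℝ)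
    (a : ℝ → EuclideanSpace ℝ (Fin d)) (a' : ℝ → Fin d → EuclideanSpace ℝ (Fin d))
    (n : ℕ) (τ : ℕ → ℝ) : ℝ :=
  ∑ k ∈ Finset.range n,
    ((∑ i, a (τ k) i * (X (τ (k + 1)) i - X (τ k) i)) +
      ∑ i, ∑ j, a' (τ k) i j * XX (τ k) (τ (k + 1)) j i)

/-- `I` is the controlled rough integral `∫_s^t a_r · d𝐗_r` (for `s ≤ t`): the Riemann sums along
partitions `s = τ_0 ≤ ⋯ ≤ τ_n = t` converge to `I` as the mesh tends to zero. -/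
def HasRoughIntegral (X : ℝ → EuclideanSpace ℝ (Fin d)) (XX : ℝ → ℝ → Fin d → Fin d → ℝ)
    (a : ℝ → EuclideanSpace ℝ (Fin d)) (a' : ℝ → Fin d → EuclideanSpace ℝ (Fin d))
    (s t I : ℝ) : Prop :=
  ∀ ε > 0, ∃ δ > 0, ∀ (n : ℕ) (τ : ℕ → ℝ), τ 0 = s → τ n = t →
    (∀ k < n, τ k ≤ τ (k + 1) ∧ τ (k + 1) - τ k < δ) →
      |roughSum X XX a a' n τ - I| < ε

/-! ### Function spaces and pairings -/

/-- Lebesgue measure on `[0,T] × ℝ^d`. -/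
def spaceTime (d : ℕ) (T : ℝ) : Measure (ℝ × EuclideanSpace ℝ (Fin d)) :=
  (volume.restrict (Set.Icc 0 T)).prod volume

/-- `b ∈ L^∞([0,T]; Lin(ℝ^d))`: `b` is measurable and `|b_t(x)| / (1 + |x|)` is essentially
bounded. -/
def IsLinftyLin (T : ℝ) (b : ℝ → EuclideanSpace ℝ (Fin d) → EuclideanSpace ℝ (Fin d)) : Prop :=
  MemLp (fun p : ℝ × EuclideanSpace ℝ (Fin d) => (1 + ‖p.2‖)⁻¹ • b p.1 p.2) ⊤ (spaceTime d T)

/-- `φ ∈ C_c^∞(ℝ^d)`. -/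
def IsTestFunction (φ : EuclideanSpace ℝ (Fin d) → ℝ) : Prop :=
  ContDiff ℝ ∞ φ ∧ HasCompactSupport φ

/-- The partial derivative `∂_i φ`. -/
def partialDeriv (i : Fin d) (φ : EuclideanSpace ℝ (Fin d) → ℝ)
    (x : EuclideanSpace ℝ (Fin d)) : ℝ :=
  fderiv ℝ φ x (EuclideanSpace.single i 1)

/-- `β_t` is the distributional divergence of `b_t` for almost every `t ∈ [0,T]`. -/
def IsWeakDiv (T : ℝ) (b : ℝ → EuclideanSpace ℝ (Fin d) → EuclideanSpace ℝ (Fin d))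
    (β : ℝ → EuclideanSpace ℝ (Fin d) → ℝ) : Prop :=
  ∀ᵐ t ∂(volume.restrict (Set.Icc 0 T)), ∀ φ : EuclideanSpace ℝ (Fin d) → ℝ, IsTestFunction φ →
    ∫ x, β t x * φ x = - ∫ x, ∑ i, b t x i * partialDeriv i φ x

/-- The pairing `v(φ) = ∫ v φ dx`. -/
def pairing (v φ : EuclideanSpace ℝ (Fin d) → ℝ) : ℝ :=
  ∫ x, v x * φ x

/-- The vector `v(∇φ) = (v(∂_1 φ), …, v(∂_d φ))`. -/
def pairingGrad (v φ : EuclideanSpace ℝ (Fin d) → ℝ) : EuclideanSpace ℝ (Fin d) :=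
  WithLp.toLp 2 (fun i => pairing v (partialDeriv i φ))

/-! ### Weak controlled solutions -/

/-- `u` is a weak controlled solution of `∂_t u + b · ∇u + ∇u · d𝐗 = 0`, `u|_{t=0} = u₀`,
on `[0,T]`, where `𝐗 = (X, XX)` and `β = div b`. The function `u` is the representative of an
element of `L^∞([0,T] × ℝ^d)` whose pairings `u_t(φ)` are meaningful at every time `t`. The
derivative of `u(φ)` as a controlled path is `u(∇φ)`; so that of `u(∂_i φ)` is `u(∇ ∂_i φ)`, which
enters the rough integral of `u(∇φ)`. -/
structure IsWeakControlledSolution (γ T : ℝ) (X : ℝ → EuclideanSpace ℝ (Fin d))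
    (XX : ℝ → ℝ → Fin d → Fin d → ℝ)
    (b : ℝ → EuclideanSpace ℝ (Fin d) → EuclideanSpace ℝ (Fin d))
    (β : ℝ → EuclideanSpace ℝ (Fin d) → ℝ)
    (u₀ : EuclideanSpace ℝ (Fin d) → ℝ) (u : ℝ → EuclideanSpace ℝ (Fin d) → ℝ) : Prop where
  memLp : MemLp (fun p : ℝ × EuclideanSpace ℝ (Fin d) => u p.1 p.2) ⊤ (spaceTime d T)
  memLp_slice : ∀ t ∈ Set.Icc (0 : ℝ) T, MemLp (u t) ⊤ volume
  controlled : ∀ φ : EuclideanSpace ℝ (Fin d) → ℝ, IsTestFunction φ →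
    IsControlled γ T X (fun t => pairing (u t) φ) (fun t => pairingGrad (u t) φ)
  equation : ∀ φ : EuclideanSpace ℝ (Fin d) → ℝ, IsTestFunction φ →
    ∀ t ∈ Set.Icc (0 : ℝ) T, ∃ I : ℝ,
      HasRoughIntegral X XX (fun s => pairingGrad (u s) φ)
        (fun s i => pairingGrad (u s) (partialDeriv i φ)) 0 t I ∧
      pairing (u t) φ = pairing u₀ φ
        + (∫ s in (0 : ℝ)..t,
            pairing (u s) (fun x => (∑ i, b s x i * partialDeriv i φ x) + β s x * φ x))
        + I

end RoughTransport

end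

/-! Geometricity lets the noise be removed by a change of variables. With `Z t = X t - X 0`, the
function `v_t(x) = u_t(x + Z_t)` should solve a transport equation without noise, with field `c_t(x)
= b_t(x + Z_t)`. This field still has linear growth and bounded divergence `β'`. So it suffices to
solve that equation and put `u_t(x) = v_t(x - Z_t)`.

Solving it requires neither regularisation of the field nor uniqueness. For a smooth `χ` vanishing
at time `T`, the operator `A χ = ∂_t χ + c · ∇χ + β' χ` is in divergence form, so its space-time
integral is `-∫ χ(0, ·)`. Applied to a smooth version of `|χ|` this gives `∫ |χ(0, ·)| ≤ ∫ |A χ|`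
(`IsSpaceTimeTest.integral_abs_le`). Hence `χ ↦ -∫ u₀ χ(0, ·)` is bounded by `M` times the `L¹` norm
of `A χ`, where `M` bounds `|u₀|`. Hahn-Banach and the duality of `L¹` and `L^∞`
(`exists_bounded_repr`) represent it by a function bounded by `M`, which is a distributional
solution. The du Bois-Reymond lemma and duality at each fixed time then give slices satisfying the
integrated equation at every `t` (`exists_transport_solution`).

Going back, `u_t(φ) = v_t(φ(· + Z_t))`. Only the test function is translated, so the dependence on
`Z` is smooth although `v_t` is merely bounded. A Taylor expansion in `Z_t - Z_s`, together with the
drift over `[s, t]`, expands the increments of `u(φ)` with remainders of orders `γ`, `2γ` and `3γ`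
(`IsTransportSolution.exists_increment_bounds`). The quadratic term is half the Hessian contracted
with the tensor square of `X_t - X_s`. The Hessian is symmetric and the symmetric part of the second
level is half that square (`IsGeometricRoughPath.add_swap`), so this is exactly the second-level
term of the rough sums. Since `3γ > 1`, the errors vanish with the mesh
(`hasRoughIntegral_of_germ`). -/

namespace RoughTransport

/-! ### Duality between `L¹` and `L^∞` -/

section Duality

variable {α : Type*} [MeasurableSpace α] {μ : Measure α}

/-- A σ-finite measure admits a positive square-integrable function. -/
theorem exists_pos_memLp_two (μ : Measure α) [SigmaFinite μ] :
    ∃ w : α → ℝ, Measurable w ∧ (∀ x, 0 < w x) ∧ MemLp w 2 μ := by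
  obtain ⟨g, hg0, hgm, hg⟩ := exists_pos_lintegral_lt_of_sigmaFinite μ (ε := 1) one_ne_zero
  refine ⟨fun x => Real.sqrt (g x), by fun_prop, fun x => Real.sqrt_pos.2 (by exact_mod_cast hg0 x),
    ?_⟩
  rw [memLp_two_iff_integrable_sq (by fun_prop)]
  have : (fun x => Real.sqrt (g x : ℝ) ^ 2) = fun x => (g x : ℝ) := by
    funext x; exact Real.sq_sqrt (g x).2
  rw [this]
  refine ⟨by fun_prop, ?_⟩
  rw [hasFiniteIntegral_iff_enorm]
  refine lt_of_le_of_lt (le_of_eq ?_) (hg.trans ENNReal.one_lt_top)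
  congr 1; funext x
  simp

/-- The Cauchy-Schwarz inequality for the product with a fixed square-integrable function. -/
theorem exists_integral_norm_mul_le {w : α → ℝ} (hw : MemLp w 2 μ) :
    ∃ C : ℝ, ∀ g : Lp ℝ 2 μ, ∫ x, ‖w x * g x‖ ∂μ ≤ C * ‖g‖ := by
  have hA : MemLp (fun x => ‖w x‖) 2 μ := hw.norm
  refine ⟨‖hA.toLp‖, fun g => ?_⟩
  have hB : MemLp (fun x => ‖g x‖) 2 μ := (Lp.memLp g).norm
  have h2 : ∫ x, ‖w x * g x‖ ∂μ = inner ℝ hB.toLp hA.toLp := by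
    rw [L2.inner_def]
    refine integral_congr_ae ?_
    filter_upwards [hA.coeFn_toLp, hB.coeFn_toLp] with x h1 h2
    rw [h1, h2, norm_mul]
    rfl
  have h3 : ‖hB.toLp‖ = ‖g‖ := by
    rw [Lp.norm_toLp, Lp.norm_def, eLpNorm_norm]
  rw [h2, mul_comm, ← h3]
  exact real_inner_le_norm _ _

/-- A bounded functional on `L¹` of a σ-finite measure is given by a bounded function. -/
theorem exists_bounded_of_functional [SigmaFinite μ] (Φ : Lp ℝ 1 μ →ₗ[ℝ] ℝ) {M : ℝ} (hM : 0 ≤ M)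
    (hΦ : ∀ g, |Φ g| ≤ M * ‖g‖) :
    ∃ v : α → ℝ, Measurable v ∧ (∀ x, |v x| ≤ M) ∧
      ∀ f : α → ℝ, ∀ hf : Integrable f μ, Φ hf.toL1 = ∫ x, v x * f x ∂μ := by
  obtain ⟨w, hwm, hw0, hw⟩ := exists_pos_memLp_two μ
  have hint : ∀ g : Lp ℝ 2 μ, Integrable (fun x => w x * g x) μ := fun g =>
    hw.integrable_mul (Lp.memLp g)
  -- By Cauchy-Schwarz, multiplication by `w` maps `L²` boundedly into `L¹`. Pulling `Φ` back along
  -- `J` makes the Riesz theorem of the Hilbert space `L²` available.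
  let J : Lp ℝ 2 μ →ₗ[ℝ] Lp ℝ 1 μ :=
    { toFun := fun g => (hint g).toL1
      map_add' := fun g h => by
        rw [← Integrable.toL1_add]
        refine (Integrable.toL1_eq_toL1_iff _ _ _ _).2 ?_
        filter_upwards [Lp.coeFn_add g h] with x hx
        rw [hx, Pi.add_apply, Pi.add_apply, mul_add]
      map_smul' := fun a g => by
        rw [RingHom.id_apply, ← Integrable.toL1_smul']
        refine (Integrable.toL1_eq_toL1_iff _ _ _ _).2 ?_
        filter_upwards [Lp.coeFn_smul a g] with x hx
        rw [hx, Pi.smul_apply, Pi.smul_apply, smul_eq_mul, smul_eq_mul, mul_left_comm] }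
  obtain ⟨C, hC⟩ := exists_integral_norm_mul_le hw
  have hJ : ∀ g, ‖J g‖ ≤ C * ‖g‖ := fun g =>
    (L1.norm_of_fun_eq_integral_norm (hint g)).trans_le (hC g)
  let Ψ : StrongDual ℝ (Lp ℝ 2 μ) := LinearMap.mkContinuous (Φ ∘ₗ J) (M * C) fun g => by
    rw [mul_assoc]
    exact (hΦ _).trans (mul_le_mul_of_nonneg_left (hJ g) hM)
  obtain ⟨h, hh⟩ : ∃ h : Lp ℝ 2 μ, ∀ g : Lp ℝ 2 μ, Φ (J g) = ∫ x, h x * g x ∂μ := by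
    refine ⟨(InnerProductSpace.toDual ℝ _).symm Ψ, fun g => ?_⟩
    have : Φ (J g) = Ψ g := rfl
    rw [this, ← InnerProductSpace.toDual_symm_apply, L2.inner_def]
    refine integral_congr_ae (ae_of_all _ fun x => ?_)
    simp [mul_comm]
  -- Testing with indicators localises the bound on `Φ`; it will give `|h| ≤ M w` almost everywhere,
  -- so that `h / w` is the bounded density sought.
  have hloc : ∀ A : Set α, MeasurableSet A → μ A < ⊤ → |∫ x in A, h x ∂μ| ≤ M * ∫ x in A, w x ∂μ := by
    intro A hA hμA
    set g : Lp ℝ 2 μ := indicatorConstLp 2 hA hμA.ne (1 : ℝ)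
    have hg : g =ᵐ[μ] A.indicator fun _ => (1 : ℝ) := indicatorConstLp_coeFn
    have e1 : Φ (J g) = ∫ x in A, h x ∂μ := by
      rw [hh, ← integral_indicator hA]
      refine integral_congr_ae ?_
      filter_upwards [hg] with x hx
      rw [hx]; by_cases hxA : x ∈ A <;> simp [hxA]
    have e2 : ‖J g‖ = ∫ x in A, w x ∂μ := by
      have : ‖J g‖ = ∫ x, ‖w x * g x‖ ∂μ := L1.norm_of_fun_eq_integral_norm (hint g)
      rw [this, ← integral_indicator hA]
      refine integral_congr_ae ?_
      filter_upwards [hg] with x hx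
      rw [hx]; by_cases hxA : x ∈ A <;> simp [hxA, abs_of_pos (hw0 x)]
    rw [← e1, ← e2]
    exact hΦ _
  have hiw : ∀ A : Set α, MeasurableSet A → μ A < ⊤ → IntegrableOn w A μ := fun A hA hμA => by
    have : IsFiniteMeasure (μ.restrict A) := ⟨by simpa using hμA⟩
    exact (hw.restrict A).integrable one_le_two
  have hih : ∀ A : Set α, MeasurableSet A → μ A < ⊤ → IntegrableOn h A μ := fun A hA hμA => by
    have : IsFiniteMeasure (μ.restrict A) := ⟨by simpa using hμA⟩
    exact ((Lp.memLp h).restrict A).integrable one_le_two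
  have hle1 : ∀ᵐ x ∂μ, 0 ≤ M * w x - h x := by
    refine ae_nonneg_of_forall_setIntegral_nonneg_of_sigmaFinite
      (fun A hA hμA => ((hiw A hA hμA).const_mul M).sub (hih A hA hμA)) fun A hA hμA => ?_
    rw [integral_sub ((hiw A hA hμA).const_mul M) (hih A hA hμA), integral_const_mul]
    linarith [(abs_le.1 (hloc A hA hμA)).2]
  have hle2 : ∀ᵐ x ∂μ, 0 ≤ M * w x + h x := by
    refine ae_nonneg_of_forall_setIntegral_nonneg_of_sigmaFinite
      (fun A hA hμA => ((hiw A hA hμA).const_mul M).add (hih A hA hμA)) fun A hA hμA => ?_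
    rw [integral_add ((hiw A hA hμA).const_mul M) (hih A hA hμA), integral_const_mul]
    linarith [(abs_le.1 (hloc A hA hμA)).1]
  -- Clamping changes `h / w` only on a null set and makes the bound hold at every point.
  set v : α → ℝ := fun x => max (-M) (min M (h x / w x)) with hv
  have hvm : Measurable v :=
    measurable_const.max (measurable_const.min ((Lp.stronglyMeasurable h).measurable.div hwm))
  have hvM : ∀ x, |v x| ≤ M := fun x =>
    abs_le.2 ⟨le_max_left _ _, max_le (by linarith) (min_le_left _ _)⟩
  have hvw : ∀ᵐ x ∂μ, h x = v x * w x := by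
    filter_upwards [hle1, hle2] with x h1 h2
    have hx : |h x / w x| ≤ M := by
      rw [abs_div, abs_of_pos (hw0 x), div_le_iff₀ (hw0 x)]
      exact abs_le.2 ⟨by linarith, by linarith⟩
    rw [hv]
    simp only
    rw [min_eq_right (abs_le.1 hx).2, max_eq_right (abs_le.1 hx).1, div_mul_cancel₀ _ (hw0 x).ne']
  refine ⟨v, hvm, hvM, fun f hf => ?_⟩
  have hvint : ∀ f : α → ℝ, Integrable f μ → Integrable (fun x => v x * f x) μ := fun f hf =>
    hf.bdd_mul hvm.aestronglyMeasurable (ae_of_all _ hvM)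
  -- truncation
  obtain ⟨f', hf'm, hff'⟩ := hf.1
  have hf' : Integrable f' μ := hf.congr hff'
  let A : ℕ → Set α := fun n => {x | |f' x| ≤ n * w x ^ 2}
  have hA : ∀ n, MeasurableSet (A n) := fun n =>
    measurableSet_le (by fun_prop) (by fun_prop)
  have hfn : ∀ n, Integrable ((A n).indicator f') μ := fun n => hf'.indicator (hA n)
  have htr : ∀ n, Φ (hfn n).toL1 = ∫ x, v x * (A n).indicator f' x ∂μ := by
    intro n
    -- On `A n` the quotient is at most `n * w`, which is square-integrable; thus the truncated
    -- function lies in the range of `J`, where the representation is known.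
    have hg : MemLp (fun x => (A n).indicator f' x / w x) 2 μ := by
      refine (hw.const_mul (n : ℝ)).mono (by
        exact ((hf'm.measurable.indicator (hA n)).div hwm).aestronglyMeasurable)
        (ae_of_all _ fun x => ?_)
      by_cases hx : x ∈ A n
      · rw [Set.indicator_of_mem hx, norm_div, Real.norm_eq_abs, Real.norm_eq_abs, Real.norm_eq_abs,
          abs_of_pos (hw0 x), div_le_iff₀ (hw0 x), abs_of_nonneg (mul_nonneg n.cast_nonneg (hw0 x).le)]
        have : |f' x| ≤ n * w x ^ 2 := hx
        linarith
      · rw [Set.indicator_of_notMem hx, zero_div, norm_zero]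
        exact norm_nonneg _
    have h1 : (hfn n).toL1 = J hg.toLp := by
      refine (Integrable.toL1_eq_toL1_iff _ _ _ (hint hg.toLp)).2 ?_
      filter_upwards [hg.coeFn_toLp] with x hx
      rw [hx, mul_div_cancel₀ _ (hw0 x).ne']
    rw [h1, hh]
    refine integral_congr_ae ?_
    filter_upwards [hg.coeFn_toLp, hvw] with x hx hx2
    rw [hx, hx2, mul_assoc, mul_div_cancel₀ _ (hw0 x).ne']
  have hlimpt : ∀ x, Tendsto (fun n : ℕ => (A n).indicator f' x) atTop (𝓝 (f' x)) := fun x => by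
    obtain ⟨N, hN⟩ := exists_nat_ge (|f' x| / w x ^ 2)
    refine tendsto_const_nhds.congr' ?_
    filter_upwards [eventually_ge_atTop N] with n hn
    have : x ∈ A n := by
      have hw2 : 0 < w x ^ 2 := pow_pos (hw0 x) 2
      have : |f' x| / w x ^ 2 ≤ n := hN.trans (by exact_mod_cast hn)
      exact (div_le_iff₀ hw2).1 this
    rw [Set.indicator_of_mem this]
  have hlim1 : Tendsto (fun n => ∫ x, v x * (A n).indicator f' x ∂μ) atTop
      (𝓝 (∫ x, v x * f' x ∂μ)) := by
    refine tendsto_integral_of_dominated_convergence (fun x => M * |f' x|)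
      (fun n => (hvint _ (hfn n)).1) (hf'.abs.const_mul M) (fun n => ae_of_all _ fun x => ?_)
      (ae_of_all _ fun x => (hlimpt x).const_mul _)
    rw [Real.norm_eq_abs, abs_mul]
    refine mul_le_mul (hvM x) ?_ (abs_nonneg _) hM
    by_cases hx : x ∈ A n <;> simp [hx]
  have hlim2 : Tendsto (fun n => Φ (hfn n).toL1) atTop (𝓝 (Φ hf'.toL1)) := by
    have h0 : Tendsto (fun n => ∫ x, ‖(A n).indicator f' x - f' x‖ ∂μ) atTop (𝓝 0) := by
      have := tendsto_integral_of_dominated_convergence (μ := μ)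
        (F := fun (n : ℕ) x => ‖(A n).indicator f' x - f' x‖) (f := fun _ => 0)
        (fun x => 2 * |f' x|) (fun n => ((hfn n).sub hf').norm.1) (hf'.abs.const_mul 2)
        (fun n => ae_of_all _ fun x => ?_) (ae_of_all _ fun x => ?_)
      · simpa using this
      · by_cases hx : x ∈ A n <;> simp [hx]
        linarith [abs_nonneg (f' x)]
      · have := ((hlimpt x).sub_const (f' x)).norm
        simpa using this
    rw [tendsto_iff_norm_sub_tendsto_zero]
    refine squeeze_zero (fun _ => norm_nonneg _) (fun n => ?_) (by simpa using h0.const_mul M)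
    rw [← map_sub, ← Integrable.toL1_sub, Real.norm_eq_abs]
    refine (hΦ _).trans (le_of_eq ?_)
    rw [L1.norm_of_fun_eq_integral_norm]
    rfl
  have e : Φ hf.toL1 = Φ hf'.toL1 := by
    rw [(Integrable.toL1_eq_toL1_iff _ _ hf hf').2 hff']
  rw [e, tendsto_nhds_unique hlim2 (by simpa only [htr] using hlim1)]
  refine integral_congr_ae ?_
  filter_upwards [hff'] with x hx
  rw [hx]

/-- A linear functional dominated by the `L¹` norm of `A ψ` is the pairing of `A ψ` with a bounded
function. -/
theorem exists_bounded_repr (μ : Measure α) [SigmaFinite μ] {V : Type*} [AddCommGroup V]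
    [Module ℝ V] (A : V →ₗ[ℝ] α → ℝ) (hA : ∀ ψ, Integrable (A ψ) μ) (l : V →ₗ[ℝ] ℝ) {M : ℝ}
    (hM : 0 ≤ M) (hl : ∀ ψ, |l ψ| ≤ M * ∫ x, |A ψ x| ∂μ) :
    ∃ v : α → ℝ, Measurable v ∧ (∀ x, |v x| ≤ M) ∧ ∀ ψ, l ψ = ∫ x, v x * A ψ x ∂μ := by
  let L : V →ₗ[ℝ] Lp ℝ 1 μ :=
    { toFun := fun ψ => (hA ψ).toL1
      map_add' := fun ψ χ => by
        rw [← Integrable.toL1_add]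
        exact (Integrable.toL1_eq_toL1_iff _ _ _ _).2 (by rw [map_add])
      map_smul' := fun a ψ => by
        rw [RingHom.id_apply, ← Integrable.toL1_smul']
        exact (Integrable.toL1_eq_toL1_iff _ _ _ _).2 (by rw [map_smul]) }
  have hL : ∀ ψ, ‖L ψ‖ = ∫ x, |A ψ x| ∂μ := fun ψ => L1.norm_of_fun_eq_integral_norm (hA ψ)
  -- A linear section of `L` transports `l` to the range of `L`. The choice of section is harmless,
  -- since the domination forces `l` to vanish on the kernel of `L`.
  obtain ⟨s, hs⟩ := L.rangeRestrict.exists_rightInverse_of_surjective L.range_rangeRestrict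
  have hs' : ∀ y : L.range, L (s y) = y := fun y => by
    have := congrArg Subtype.val (LinearMap.congr_fun hs y)
    simpa using this
  -- Hahn-Banach extends the functional to all of `L¹` without increasing the constant `M`.
  obtain ⟨Φ, hΦ1, hΦ2⟩ := exists_extension_of_le_sublinear ⟨L.range, l ∘ₗ s⟩ (fun g => M * ‖g‖)
    (fun c hc x => by rw [norm_smul, Real.norm_eq_abs, abs_of_pos hc]; ring)
    (fun x y => by rw [← mul_add]; exact mul_le_mul_of_nonneg_left (norm_add_le x y) hM)
    (fun y => by
      refine (le_abs_self _).trans ((hl _).trans (le_of_eq ?_))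
      rw [← hL, hs'])
  obtain ⟨v, hvm, hvM, hv⟩ := exists_bounded_of_functional Φ hM fun g => by
    refine abs_le.2 ⟨?_, hΦ2 g⟩
    have := hΦ2 (-g)
    rw [map_neg, norm_neg] at this
    linarith
  refine ⟨v, hvm, hvM, fun ψ => ?_⟩
  rw [← hv _ (hA ψ)]
  have h1 : Φ (L ψ) = l (s ⟨L ψ, LinearMap.mem_range_self L ψ⟩) := hΦ1 ⟨L ψ, _⟩
  have h2 : l (s ⟨L ψ, LinearMap.mem_range_self L ψ⟩ - ψ) = 0 := by
    have := hl (s ⟨L ψ, LinearMap.mem_range_self L ψ⟩ - ψ)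
    rw [← hL, map_sub L, hs', sub_self, norm_zero, mul_zero] at this
    exact abs_nonpos_iff.1 this
  rw [map_sub, sub_eq_zero] at h2
  rw [← h2, ← h1]
  rfl

end Duality

/-! ### Test functions and integrability -/

/-- The space variable ranges over `ℝ^d`. -/
abbrev Space (d : ℕ) : Type := EuclideanSpace ℝ (Fin d)

section TestFunctions

variable {d : ℕ} {T : ℝ}

theorem fderiv_apply_eq_sum (φ : Space d → ℝ) (x y : Space d) :
    fderiv ℝ φ x y = ∑ i, y i * partialDeriv i φ x := by
  conv_lhs => rw [← (EuclideanSpace.basisFun (Fin d) ℝ).sum_repr y]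
  simp [partialDeriv]

theorem IsTestFunction.continuous {φ : Space d → ℝ} (h : IsTestFunction φ) : Continuous φ :=
  h.1.continuous

theorem IsTestFunction.integrable {φ : Space d → ℝ} (h : IsTestFunction φ) : Integrable φ :=
  h.continuous.integrable_of_hasCompactSupport h.2

theorem IsTestFunction.add {φ ψ : Space d → ℝ} (h : IsTestFunction φ) (h' : IsTestFunction ψ) :
    IsTestFunction (φ + ψ) :=
  ⟨h.1.add h'.1, h.2.add h'.2⟩

theorem IsTestFunction.smul {φ : Space d → ℝ} (h : IsTestFunction φ) (a : ℝ) :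
    IsTestFunction (a • φ) :=
  ⟨contDiff_const.smul h.1, h.2.smul_left (f := fun _ => a)⟩

theorem IsTestFunction.partialDeriv {φ : Space d → ℝ} (h : IsTestFunction φ) (i : Fin d) :
    IsTestFunction (partialDeriv i φ) :=
  ⟨(h.1.fderiv_right (m := ∞) (by simp)).clm_apply contDiff_const,
    (h.2.fderiv (𝕜 := ℝ)).comp_left (g := fun L : Space d →L[ℝ] ℝ => L (EuclideanSpace.single i 1))
      rfl⟩

theorem IsTestFunction.translate {φ : Space d → ℝ} (h : IsTestFunction φ) (z : Space d) :
    IsTestFunction (fun x => φ (x + z)) :=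
  ⟨h.1.comp (contDiff_id.add contDiff_const), h.2.comp_homeomorph (Homeomorph.addRight z)⟩

theorem partialDeriv_translate (φ : Space d → ℝ) (z x : Space d) (i : Fin d) :
    RoughTransport.partialDeriv i (fun y => φ (y + z)) x
      = RoughTransport.partialDeriv i φ (x + z) := by
  simp only [RoughTransport.partialDeriv]
  rw [fderiv_comp_add_right]

theorem partialDeriv_add {φ ψ : Space d → ℝ} (h : IsTestFunction φ) (h' : IsTestFunction ψ)
    (i : Fin d) (x : Space d) : RoughTransport.partialDeriv i (φ + ψ) x
      = RoughTransport.partialDeriv i φ x + RoughTransport.partialDeriv i ψ x := by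
  simp only [RoughTransport.partialDeriv]
  rw [fderiv_add (h.1.differentiable (by simp) x) (h'.1.differentiable (by simp) x)]
  rfl

theorem partialDeriv_smul {φ : Space d → ℝ} (h : IsTestFunction φ) (a : ℝ)
    (i : Fin d) (x : Space d) : RoughTransport.partialDeriv i (a • φ) x
      = a * RoughTransport.partialDeriv i φ x := by
  simp only [RoughTransport.partialDeriv]
  rw [fderiv_const_smul (h.1.differentiable (by simp) x)]
  rfl

/-- Symmetry of the Hessian is what makes the antisymmetric part of the second level invisible to
the rough sums. -/
theorem partialDeriv_comm {φ : Space d → ℝ} (h : IsTestFunction φ) (i j : Fin d) (x : Space d) :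
    RoughTransport.partialDeriv j (RoughTransport.partialDeriv i φ) x
      = RoughTransport.partialDeriv i (RoughTransport.partialDeriv j φ) x := by
  have hd : DifferentiableAt ℝ (fderiv ℝ φ) x :=
    (h.1.fderiv_right (m := ∞) (by simp)).differentiable (by simp) x
  have key : ∀ i j : Fin d, RoughTransport.partialDeriv j (RoughTransport.partialDeriv i φ) x
      = fderiv ℝ (fderiv ℝ φ) x (EuclideanSpace.single j 1) (EuclideanSpace.single i 1) := by
    intro i j
    unfold RoughTransport.partialDeriv
    rw [fderiv_clm_apply hd (differentiableAt_const _)]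
    simp
  rw [key, key]
  have := (h.1.contDiffAt (x := x)).isSymmSndFDerivAt
    (by simpa using WithTop.coe_le_coe.2 (le_top (a := (2 : ℕ∞))))
  exact this _ _

/-- The submodule of test functions. -/
def testSubmodule (d : ℕ) : Submodule ℝ (Space d → ℝ) where
  carrier := {φ | IsTestFunction φ}
  add_mem' := IsTestFunction.add
  zero_mem' := ⟨contDiff_const, HasCompactSupport.zero⟩
  smul_mem' a _ h := h.smul a

theorem IsTestFunction.exists_bound {φ : Space d → ℝ} (h : IsTestFunction φ) :
    ∃ R K : ℝ, 0 ≤ R ∧ 0 ≤ K ∧ (∀ x, |φ x| ≤ K) ∧ (∀ x, ‖fderiv ℝ φ x‖ ≤ K) ∧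
      ∀ x, R < ‖x‖ → φ x = 0 ∧ fderiv ℝ φ x = 0 := by
  obtain ⟨K₁, hK₁⟩ := h.continuous.bounded_above_of_compact_support h.2
  obtain ⟨K₂, hK₂⟩ := (h.1.continuous_fderiv (by simp)).bounded_above_of_compact_support
    (h.2.fderiv (𝕜 := ℝ))
  obtain ⟨R, hR⟩ := h.2.isCompact.isBounded.subset_closedBall 0
  refine ⟨max R 0, max K₁ K₂, le_max_right _ _,
    (norm_nonneg _).trans ((hK₁ 0).trans (le_max_left _ _)),
    fun x => (hK₁ x).trans (le_max_left _ _), fun x => (hK₂ x).trans (le_max_right _ _),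
    fun x hx => ?_⟩
  have hx' : x ∉ tsupport φ := fun hm => by
    have := hR hm
    rw [mem_closedBall_zero_iff] at this
    exact absurd ((le_max_left R 0).trans_lt hx) (not_lt.2 this)
  exact ⟨image_eq_zero_of_notMem_tsupport hx', by
    by_contra hne
    exact hx' (support_fderiv_subset ℝ hne)⟩

instance (d : ℕ) (T : ℝ) : SigmaFinite (spaceTime d T) := by
  unfold spaceTime; infer_instance

theorem spaceTime_ae_mem (d : ℕ) (T : ℝ) : ∀ᵐ p ∂spaceTime d T, p.1 ∈ Set.Icc 0 T :=
  Measure.quasiMeasurePreserving_fst.ae (ae_restrict_mem measurableSet_Icc)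

theorem spaceTime_ae_slice {P : ℝ × Space d → Prop} (h : ∀ᵐ p ∂spaceTime d T, P p) :
    ∀ᵐ t ∂(volume.restrict (Set.Icc 0 T)), ∀ᵐ x, P (t, x) :=
  Measure.ae_ae_of_ae_prod h

theorem integrable_indicator_ball (d : ℕ) (T R K : ℝ) :
    Integrable (fun p : ℝ × Space d => (Metric.closedBall (0 : Space d) R).indicator
      (fun _ => K) p.2) (spaceTime d T) := by
  have h1 : Integrable ((Metric.closedBall (0 : Space d) R).indicator (fun _ => K)) volume :=
    (integrable_indicator_iff measurableSet_closedBall).2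
      (integrableOn_const (measure_closedBall_lt_top).ne)
  exact h1.comp_snd _

/-- A bounded measurable function supported in a cylinder is integrable on space-time. -/
theorem integrable_of_bounded_of_cylinder {f : ℝ × Space d → ℝ}
    (hf : AEStronglyMeasurable f (spaceTime d T)) {R K : ℝ}
    (hK : ∀ᵐ p ∂spaceTime d T, ‖p.2‖ ≤ R → |f p| ≤ K)
    (hR : ∀ᵐ p ∂spaceTime d T, R < ‖p.2‖ → f p = 0) : Integrable f (spaceTime d T) := by
  refine (integrable_indicator_ball d T R K).mono' hf ?_
  filter_upwards [hK, hR] with p h1 h2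
  by_cases hp : ‖p.2‖ ≤ R
  · rw [Set.indicator_of_mem (mem_closedBall_zero_iff.2 hp)]
    exact h1 hp
  · rw [Set.indicator_of_notMem (fun h => hp (mem_closedBall_zero_iff.1 h)), h2 (not_le.1 hp),
      norm_zero]

end TestFunctions

/-! ### The transport operator -/

section Operator

variable {d : ℕ} {T : ℝ} {c : ℝ → Space d → Space d} {β : ℝ → Space d → ℝ}

/-- The operator `c_t · ∇φ + β_t φ` in the space variable. -/
noncomputable def driftOp (c : ℝ → Space d → Space d) (β : ℝ → Space d → ℝ) (t : ℝ) (φ : Space d → ℝ)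
    (x : Space d) : ℝ :=
  (∑ i, c t x i * partialDeriv i φ x) + β t x * φ x

/-- The operator `∂_t χ + c · ∇χ + β χ`. -/
noncomputable def transportOp (c : ℝ → Space d → Space d) (β : ℝ → Space d → ℝ) (χ : ℝ × Space d → ℝ)
    (p : ℝ × Space d) : ℝ :=
  fderiv ℝ χ p (1, c p.1 p.2) + β p.1 p.2 * χ p

theorem driftOp_eq (t : ℝ) (φ : Space d → ℝ) (x : Space d) :
    driftOp c β t φ x = fderiv ℝ φ x (c t x) + β t x * φ x := by
  rw [driftOp, fderiv_apply_eq_sum]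

/-- The hypothesis only concerns the weighted field; multiplying back by `1 + ‖x‖` recovers the
field itself. -/
theorem IsLinftyLin.aestronglyMeasurable (hc : IsLinftyLin T c) :
    AEStronglyMeasurable (fun p : ℝ × Space d => c p.1 p.2) (spaceTime d T) := by
  have h1 : AEStronglyMeasurable (fun p : ℝ × Space d => 1 + ‖p.2‖) (spaceTime d T) :=
    (by fun_prop : Continuous fun p : ℝ × Space d => 1 + ‖p.2‖).aestronglyMeasurable
  refine (h1.smul hc.1).congr (ae_of_all _ fun p => ?_)
  have : (1 + ‖p.2‖) ≠ 0 := by positivity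
  simp [smul_smul, mul_inv_cancel₀ this]

theorem exists_ae_bound {α F : Type*} [MeasurableSpace α] [NormedAddCommGroup F] {μ : Measure α}
    {f : α → F} (hf : MemLp f ⊤ μ) : ∃ C : ℝ, 0 ≤ C ∧ ∀ᵐ x ∂μ, ‖f x‖ ≤ C := by
  refine ⟨(eLpNorm f ⊤ μ).toReal, ENNReal.toReal_nonneg, ?_⟩
  have := ae_le_eLpNormEssSup (f := f) (μ := μ)
  filter_upwards [this] with x hx
  rw [← eLpNorm_exponent_top] at hx
  rw [← toReal_enorm]
  exact ENNReal.toReal_mono hf.2.ne hx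

theorem IsLinftyLin.exists_bound (hc : IsLinftyLin T c) :
    ∃ C : ℝ, 0 ≤ C ∧ ∀ᵐ p ∂spaceTime d T, ‖c p.1 p.2‖ ≤ C * (1 + ‖p.2‖) := by
  obtain ⟨C, hC0, hC⟩ := exists_ae_bound hc
  refine ⟨C, hC0, ?_⟩
  filter_upwards [hC] with p hp
  have h0 : 0 < 1 + ‖p.2‖ := by positivity
  rw [norm_smul, norm_inv, Real.norm_of_nonneg h0.le, inv_mul_le_iff₀ h0] at hp
  linarith

/-- A space-time test function: smooth, of compact support in space, and zero at the time `T`. -/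
structure IsSpaceTimeTest (T : ℝ) (χ : ℝ × Space d → ℝ) : Prop where
  contDiff : ContDiff ℝ ∞ χ
  support : ∃ R : ℝ, ∀ t x, R < ‖x‖ → χ (t, x) = 0
  final : ∀ x, χ (T, x) = 0

theorem fderiv_eq_zero_of_cylinder {χ : ℝ × Space d → ℝ} {R : ℝ}
    (hR : ∀ t x, R < ‖x‖ → χ (t, x) = 0) {p : ℝ × Space d} (hp : R < ‖p.2‖) :
    fderiv ℝ χ p = 0 := by
  have : χ =ᶠ[𝓝 p] fun _ => (0 : ℝ) := by
    have ho : IsOpen {q : ℝ × Space d | R < ‖q.2‖} :=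
      isOpen_lt continuous_const (by fun_prop)
    filter_upwards [ho.mem_nhds hp] with q hq
    exact hR q.1 q.2 hq
  rw [this.fderiv_eq]
  simp

theorem IsSpaceTimeTest.exists_bound {χ : ℝ × Space d → ℝ} (h : IsSpaceTimeTest T χ) :
    ∃ R K : ℝ, 0 ≤ R ∧ 0 ≤ K ∧
      (∀ p : ℝ × Space d, p.1 ∈ Set.Icc 0 T → |χ p| ≤ K ∧ ‖fderiv ℝ χ p‖ ≤ K) ∧
      ∀ p : ℝ × Space d, R < ‖p.2‖ → χ p = 0 ∧ fderiv ℝ χ p = 0 := by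
  obtain ⟨R, hR⟩ := h.support
  have hcomp : IsCompact (Set.Icc (0 : ℝ) T ×ˢ Metric.closedBall (0 : Space d) R) :=
    isCompact_Icc.prod (isCompact_closedBall _ _)
  obtain ⟨K₁, hK₁⟩ := hcomp.exists_bound_of_continuousOn h.contDiff.continuous.continuousOn
  obtain ⟨K₂, hK₂⟩ := hcomp.exists_bound_of_continuousOn
    (h.contDiff.continuous_fderiv (by simp)).continuousOn
  refine ⟨max R 0, max (max K₁ K₂) 0, le_max_right _ _, le_max_right _ _, fun p hp => ?_,
    fun p hp => ?_⟩
  · by_cases hpR : ‖p.2‖ ≤ R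
    · have hm : p ∈ Set.Icc (0 : ℝ) T ×ˢ Metric.closedBall (0 : Space d) R :=
        ⟨hp, mem_closedBall_zero_iff.2 hpR⟩
      exact ⟨(hK₁ p hm).trans ((le_max_left _ _).trans (le_max_left _ _)),
        (hK₂ p hm).trans ((le_max_right _ _).trans (le_max_left _ _))⟩
    · rw [not_le] at hpR
      rw [fderiv_eq_zero_of_cylinder hR hpR, hR p.1 p.2 hpR]
      simp
  · have hp' := (le_max_left R 0).trans_lt hp
    exact ⟨hR p.1 p.2 hp', fderiv_eq_zero_of_cylinder hR hp'⟩

theorem aestronglyMeasurable_clm_apply {α F : Type*} [MeasurableSpace α] [NormedAddCommGroup F]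
    [NormedSpace ℝ F] {μ : Measure α} {L : α → F →L[ℝ] ℝ} {f : α → F}
    (hL : AEStronglyMeasurable L μ) (hf : AEStronglyMeasurable f μ) :
    AEStronglyMeasurable (fun x => L x (f x)) μ :=
  (isBoundedBilinearMap_apply (𝕜 := ℝ) (E := F) (F := ℝ)).continuous.comp_aestronglyMeasurable
    (hL.prodMk hf)

theorem IsSpaceTimeTest.integrable_fderiv {χ : ℝ × Space d → ℝ} (h : IsSpaceTimeTest T χ)
    (hc : IsLinftyLin T c) (a : ℝ) :
    Integrable (fun p => fderiv ℝ χ p (a, c p.1 p.2)) (spaceTime d T) := by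
  obtain ⟨R, K, hR0, hK0, hK, hR⟩ := h.exists_bound
  obtain ⟨C, hC0, hC⟩ := hc.exists_bound
  refine integrable_of_bounded_of_cylinder (R := R) (K := K * (|a| + C * (1 + R)))
    (aestronglyMeasurable_clm_apply
      (h.contDiff.continuous_fderiv (by simp)).aestronglyMeasurable
      (aestronglyMeasurable_const.prodMk hc.aestronglyMeasurable)) ?_
    (ae_of_all _ fun p hp => by rw [(hR p hp).2]; rfl)
  filter_upwards [hC, spaceTime_ae_mem d T] with p h1 h2 h3
  refine ((fderiv ℝ χ p).le_opNorm _).trans (mul_le_mul (hK p h2).2 ?_ (norm_nonneg _) hK0)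
  rw [Prod.norm_mk]
  have h4 : ‖c p.1 p.2‖ ≤ C * (1 + R) :=
    h1.trans (mul_le_mul_of_nonneg_left (by linarith) hC0)
  have h5 : 0 ≤ C * (1 + R) := by positivity
  exact max_le (by rw [Real.norm_eq_abs]; linarith) (h4.trans (by linarith [abs_nonneg a]))

theorem IsSpaceTimeTest.integrable_mul {χ : ℝ × Space d → ℝ} (h : IsSpaceTimeTest T χ)
    (hβ : MemLp (fun p : ℝ × Space d => β p.1 p.2) ⊤ (spaceTime d T)) :
    Integrable (fun p => β p.1 p.2 * χ p) (spaceTime d T) := by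
  obtain ⟨R, K, hR0, hK0, hK, hR⟩ := h.exists_bound
  obtain ⟨B, hB0, hB⟩ := exists_ae_bound hβ
  refine integrable_of_bounded_of_cylinder (R := R) (K := B * K)
    (hβ.1.mul h.contDiff.continuous.aestronglyMeasurable) ?_
    (ae_of_all _ fun p hp => by rw [(hR p hp).1, mul_zero])
  filter_upwards [hB, spaceTime_ae_mem d T] with p h1 h2 h3
  rw [abs_mul]
  exact mul_le_mul h1 (hK p h2).1 (abs_nonneg _) hB0

theorem IsSpaceTimeTest.integrable_transportOp {χ : ℝ × Space d → ℝ} (h : IsSpaceTimeTest T χ)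
    (hc : IsLinftyLin T c)
    (hβ : MemLp (fun p : ℝ × Space d => β p.1 p.2) ⊤ (spaceTime d T)) :
    Integrable (transportOp c β χ) (spaceTime d T) :=
  (h.integrable_fderiv hc 1).add (h.integrable_mul hβ)

theorem IsSpaceTimeTest.slice {χ : ℝ × Space d → ℝ} (h : IsSpaceTimeTest T χ) (t : ℝ) :
    IsTestFunction (fun x => χ (t, x)) := by
  obtain ⟨R, hR⟩ := h.support
  refine ⟨h.contDiff.comp (contDiff_const.prodMk contDiff_id), ?_⟩
  refine HasCompactSupport.intro (isCompact_closedBall (0 : Space d) R) fun x hx => hR t x ?_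
  rw [mem_closedBall_zero_iff, not_le] at hx
  exact hx

theorem IsSpaceTimeTest.fderiv_slice {χ : ℝ × Space d → ℝ} (h : IsSpaceTimeTest T χ) (t : ℝ)
    (x y : Space d) : fderiv ℝ (fun x => χ (t, x)) x y = fderiv ℝ χ (t, x) (0, y) := by
  have h1 : HasFDerivAt χ (fderiv ℝ χ (t, x)) (t, x) :=
    (h.contDiff.differentiable (by simp) _).hasFDerivAt
  have h2 := h1.comp x (hasFDerivAt_prodMk_right (𝕜 := ℝ) t x)
  have h3 : fderiv ℝ (fun x => χ (t, x)) x = _ := h2.fderiv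
  rw [h3]
  simp

theorem IsSpaceTimeTest.hasDerivAt_time {χ : ℝ × Space d → ℝ} (h : IsSpaceTimeTest T χ) (t : ℝ)
    (x : Space d) : HasDerivAt (fun t => χ (t, x)) (fderiv ℝ χ (t, x) (1, 0)) t := by
  have h1 : HasFDerivAt χ (fderiv ℝ χ (t, x)) (t, x) :=
    (h.contDiff.differentiable (by simp) _).hasFDerivAt
  have h2 := h1.comp_hasDerivAt t ((hasDerivAt_id t).prodMk (hasDerivAt_const t x))
  exact h2

theorem isLinftyLin_zero : IsLinftyLin T (fun _ _ => (0 : Space d)) := by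
  unfold IsLinftyLin
  simp

/-- The transport operator is in divergence form. -/
theorem IsSpaceTimeTest.integral_transportOp (hT : 0 < T) {χ : ℝ × Space d → ℝ}
    (h : IsSpaceTimeTest T χ) (hc : IsLinftyLin T c) (hdiv : IsWeakDiv T c β)
    (hβ : MemLp (fun p : ℝ × Space d => β p.1 p.2) ⊤ (spaceTime d T)) :
    ∫ p, transportOp c β χ p ∂spaceTime d T = -∫ x, χ (0, x) := by
  have i0 : Integrable (fun p : ℝ × Space d => fderiv ℝ χ p (1, 0)) (spaceTime d T) :=
    h.integrable_fderiv isLinftyLin_zero 1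
  have i1 := h.integrable_fderiv hc 0
  have i2 := h.integrable_mul hβ
  have e : transportOp c β χ = fun p => fderiv ℝ χ p (1, 0)
      + (fderiv ℝ χ p (0, c p.1 p.2) + β p.1 p.2 * χ p) := by
    funext p
    rw [transportOp, ← add_assoc, ← map_add]
    simp
  have i12 : Integrable (fun p => fderiv ℝ χ p (0, c p.1 p.2) + β p.1 p.2 * χ p)
      (spaceTime d T) := i1.add i2
  rw [e, integral_add i0 i12]
  -- For almost every time the slice of `χ` is an admissible test function in the definition of the
  -- weak divergence, so the two spatial terms cancel.
  have e1 : ∫ p, (fderiv ℝ χ p (0, c p.1 p.2) + β p.1 p.2 * χ p) ∂spaceTime d T = 0 := by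
    rw [spaceTime] at i1 i2 i12 ⊢
    rw [integral_prod _ i12]
    refine integral_eq_zero_of_ae ?_
    filter_upwards [hdiv, i1.prod_right_ae, i2.prod_right_ae] with t h1 h2 h3
    rw [integral_add h2 h3, h1 _ (h.slice t)]
    have : ∀ x, fderiv ℝ χ (t, x) (0, c t x)
        = ∑ i, c t x i * partialDeriv i (fun x => χ (t, x)) x := fun x => by
      rw [← fderiv_apply_eq_sum, h.fderiv_slice]
    simp only [this]
    simp
  -- Integrating in time first leaves only the boundary term at time zero, because `χ` vanishes at
  -- `T`.
  have e0 : ∫ p, fderiv ℝ χ p (1, 0) ∂spaceTime d T = -∫ x, χ (0, x) := by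
    rw [spaceTime] at i0 ⊢
    rw [integral_prod_symm _ i0, ← integral_neg]
    refine integral_congr_ae (ae_of_all _ fun x => ?_)
    beta_reduce
    rw [integral_Icc_eq_integral_Ioc, ← intervalIntegral.integral_of_le hT.le,
      intervalIntegral.integral_eq_sub_of_hasDerivAt (f := fun t => χ (t, x))
        (fun t _ => h.hasDerivAt_time t x), h.final, zero_sub]
    refine Continuous.intervalIntegrable ?_ _ _
    have := h.contDiff.continuous_fderiv (by simp)
    fun_prop
  rw [e0, e1, add_zero]

end Operator

/-! ### The `L¹` estimate and weak solutions -/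

section Smoothing

/-- A smooth approximation of the absolute value, zero at the origin. -/
noncomputable def smoothAbs (ε z : ℝ) : ℝ := √(z ^ 2 + ε ^ 2) - ε

variable {ε : ℝ}

theorem contDiff_smoothAbs (hε : 0 < ε) : ContDiff ℝ ∞ (smoothAbs ε) := by
  unfold smoothAbs
  exact (ContDiff.sqrt (by fun_prop) fun z => by positivity).sub contDiff_const

theorem smoothAbs_zero (hε : 0 < ε) : smoothAbs ε 0 = 0 := by
  simp [smoothAbs, Real.sqrt_sq hε.le]

theorem hasDerivAt_smoothAbs (hε : 0 < ε) (z : ℝ) :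
    HasDerivAt (smoothAbs ε) (z / √(z ^ 2 + ε ^ 2)) z := by
  have h1 : HasDerivAt (fun z : ℝ => z ^ 2 + ε ^ 2) (2 * z) z := by
    simpa using (hasDerivAt_pow 2 z).add_const (ε ^ 2)
  refine ((h1.sqrt (by positivity)).sub_const ε).congr_deriv ?_
  rw [mul_div_mul_left _ _ two_ne_zero]

theorem abs_deriv_smoothAbs_le (hε : 0 < ε) (z : ℝ) : |z / √(z ^ 2 + ε ^ 2)| ≤ 1 := by
  rw [abs_div, abs_of_pos (show 0 < √(z ^ 2 + ε ^ 2) by positivity)]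
  refine div_le_one_of_le₀ ?_ (by positivity)
  exact Real.abs_le_sqrt (by nlinarith)

/-- The absolute value is homogeneous of degree one, so the Euler defect `η(z) - η'(z) z` of its
smoothing `η` is small. This defect is the only error when the transport operator is applied to
`η(χ)`. -/
theorem abs_smoothAbs_sub_le (hε : 0 < ε) (z : ℝ) :
    |smoothAbs ε z - z / √(z ^ 2 + ε ^ 2) * z| ≤ ε := by
  have hs : 0 < √(z ^ 2 + ε ^ 2) := by positivity
  have hsq : √(z ^ 2 + ε ^ 2) ^ 2 = z ^ 2 + ε ^ 2 := Real.sq_sqrt (by positivity)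
  have hle : ε ≤ √(z ^ 2 + ε ^ 2) := Real.le_sqrt_of_sq_le (by nlinarith)
  have e : smoothAbs ε z - z / √(z ^ 2 + ε ^ 2) * z = ε * (ε / √(z ^ 2 + ε ^ 2)) - ε := by
    rw [smoothAbs]
    field_simp
    nlinarith
  have h1 : ε / √(z ^ 2 + ε ^ 2) ≤ 1 := div_le_one_of_le₀ hle hs.le
  have h0 : 0 ≤ ε / √(z ^ 2 + ε ^ 2) := by positivity
  rw [e, abs_le]
  constructor <;> nlinarith

theorem abs_le_smoothAbs_add (ε z : ℝ) : |z| ≤ smoothAbs ε z + ε := by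
  rw [smoothAbs, sub_add_cancel]
  exact Real.abs_le_sqrt (by nlinarith)

end Smoothing

/-! ### The backward `L¹` estimate, existence by duality, and bounds for the drift. -/

section WeakSolution

variable {d : ℕ} {T : ℝ} {c : ℝ → Space d → Space d} {β : ℝ → Space d → ℝ}

theorem IsSpaceTimeTest.smoothAbs_comp {ε : ℝ} (hε : 0 < ε) {χ : ℝ × Space d → ℝ}
    (h : IsSpaceTimeTest T χ) : IsSpaceTimeTest T (fun p => smoothAbs ε (χ p)) := by
  obtain ⟨R, hR⟩ := h.support
  exact ⟨(contDiff_smoothAbs hε).comp h.contDiff,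
    ⟨R, fun t x hx => by rw [hR t x hx, smoothAbs_zero hε]⟩,
    fun x => by rw [h.final, smoothAbs_zero hε]⟩

/-- The chain rule is exact as `χ` is smooth: the first-order terms acquire the factor `η'(χ)`, and
only the zero-order term leaves a defect. -/
theorem IsSpaceTimeTest.transportOp_smoothAbs {ε : ℝ} (hε : 0 < ε) {χ : ℝ × Space d → ℝ}
    (h : IsSpaceTimeTest T χ) (p : ℝ × Space d) :
    transportOp c β (fun p => smoothAbs ε (χ p)) p =
      χ p / √(χ p ^ 2 + ε ^ 2) * transportOp c β χ p +
        β p.1 p.2 * (smoothAbs ε (χ p) - χ p / √(χ p ^ 2 + ε ^ 2) * χ p) := by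
  have h1 : HasFDerivAt χ (fderiv ℝ χ p) p := (h.contDiff.differentiable (by simp) _).hasFDerivAt
  have h2 : HasFDerivAt (fun p => smoothAbs ε (χ p)) _ p :=
    (hasDerivAt_smoothAbs hε (χ p)).comp_hasFDerivAt p h1
  rw [transportOp, h2.fderiv, transportOp, smul_apply, smul_eq_mul]
  ring

/-- The `L¹` estimate for the backward conservative equation. -/
theorem IsSpaceTimeTest.integral_abs_le (hT : 0 < T) {χ : ℝ × Space d → ℝ}
    (h : IsSpaceTimeTest T χ) (hc : IsLinftyLin T c) (hdiv : IsWeakDiv T c β)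
    (hβ : MemLp (fun p : ℝ × Space d => β p.1 p.2) ⊤ (spaceTime d T)) :
    ∫ x, |χ (0, x)| ≤ ∫ p, |transportOp c β χ p| ∂spaceTime d T := by
  obtain ⟨R, K, hR0, hK0, hK, hR⟩ := h.exists_bound
  obtain ⟨B, hB0, hB⟩ := exists_ae_bound hβ
  set ind : Space d → ℝ := (Metric.closedBall (0 : Space d) R).indicator fun _ => 1 with hind
  have hind0 : ∀ x, 0 ≤ ind x := fun x => Set.indicator_nonneg (fun _ _ => zero_le_one) x
  have hind1 : ∀ x, ‖x‖ ≤ R → ind x = 1 := fun x hx =>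
    Set.indicator_of_mem (mem_closedBall_zero_iff.2 hx) _
  have iV : Integrable ind := (integrable_indicator_iff measurableSet_closedBall).2
      (integrableOn_const (measure_closedBall_lt_top).ne)
  have iW : Integrable (fun p : ℝ × Space d => ind p.2) (spaceTime d T) :=
    integrable_indicator_ball d T R 1
  set V := ∫ x, ind x
  set W := ∫ p, ind p.2 ∂spaceTime d T
  have hV0 : 0 ≤ V := integral_nonneg hind0
  have hW0 : 0 ≤ W := integral_nonneg fun p => hind0 p.2
  have iA := h.integrable_transportOp hc hβ
  -- The error has two sources, both confined to the ball supporting `χ`: replacing `|χ(0, ·)|` by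
  -- its smoothing costs `ε V`, and the Euler defect multiplied by the divergence costs `ε B W`.
  have key : ∀ ε > 0, ∫ x, |χ (0, x)| ≤
      (∫ p, |transportOp c β χ p| ∂spaceTime d T) + ε * (V + B * W) := by
    intro ε hε
    have hη := h.smoothAbs_comp hε
    have i1 : Integrable (fun x => smoothAbs ε (χ (0, x))) := (hη.slice 0).integrable
    have e1 : ∫ x, |χ (0, x)| ≤ (∫ x, smoothAbs ε (χ (0, x))) + ε * V := by
      rw [← integral_const_mul, ← integral_add i1 (iV.const_mul ε)]
      refine integral_mono (h.slice 0).integrable.abs (i1.add (iV.const_mul ε)) fun x => ?_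
      by_cases hx : ‖x‖ ≤ R
      · have := abs_le_smoothAbs_add ε (χ (0, x))
        simpa [hind1 x hx] using this
      · have h0 := (hR (0, x) (not_le.1 hx)).1
        simp only [h0, smoothAbs_zero hε, abs_zero, zero_add]
        exact mul_nonneg hε.le (hind0 x)
    have e2 : ∫ x, smoothAbs ε (χ (0, x)) ≤
        (∫ p, |transportOp c β χ p| ∂spaceTime d T) + ε * (B * W) := by
      have h1 := hη.integral_transportOp hT hc hdiv hβ
      have h2 : ∫ x, smoothAbs ε (χ (0, x)) ≤
          ∫ p, |transportOp c β (fun p => smoothAbs ε (χ p)) p| ∂spaceTime d T := by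
        rw [← neg_neg (∫ x, smoothAbs ε (χ (0, x))), ← h1]
        exact (neg_le_abs _).trans abs_integral_le_integral_abs
      refine h2.trans ?_
      rw [← integral_const_mul B, ← integral_const_mul ε,
        ← integral_add iA.abs ((iW.const_mul B).const_mul ε)]
      refine integral_mono_ae (hη.integrable_transportOp hc hβ).abs
        (iA.abs.add ((iW.const_mul B).const_mul ε)) ?_
      filter_upwards [hB] with p hp
      rw [h.transportOp_smoothAbs hε]
      refine (abs_add_le _ _).trans (add_le_add ?_ ?_)
      · rw [abs_mul]
        exact mul_le_of_le_one_left (abs_nonneg _) (abs_deriv_smoothAbs_le hε _)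
      · by_cases hx : ‖p.2‖ ≤ R
        · rw [hind1 _ hx, abs_mul, mul_one, mul_comm ε]
          exact mul_le_mul hp (abs_smoothAbs_sub_le hε _) (abs_nonneg _) hB0
        · have h0 := (hR p (not_le.1 hx)).1
          simp only [h0, smoothAbs_zero hε, mul_zero, sub_zero, abs_zero]
          have := hind0 p.2
          positivity
    linarith
  refine le_of_forall_pos_le_add fun δ hδ => ?_
  have hD : 0 < V + B * W + 1 := by positivity
  refine (key (δ / (V + B * W + 1)) (div_pos hδ hD)).trans ?_
  have : δ / (V + B * W + 1) * (V + B * W) ≤ δ := by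
    rw [div_mul_eq_mul_div, div_le_iff₀ hD]
    nlinarith
  linarith

/-- The submodule of space-time test functions. -/
def spaceTimeTestSubmodule (d : ℕ) (T : ℝ) : Submodule ℝ (ℝ × Space d → ℝ) where
  carrier := {χ | IsSpaceTimeTest T χ}
  add_mem' := by
    rintro χ χ' h h'
    obtain ⟨R, hR⟩ := h.support
    obtain ⟨R', hR'⟩ := h'.support
    exact ⟨h.contDiff.add h'.contDiff, ⟨max R R', fun t x hx => by
      simp [hR t x ((le_max_left _ _).trans_lt hx), hR' t x ((le_max_right _ _).trans_lt hx)]⟩,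
      fun x => by simp [h.final, h'.final]⟩
  zero_mem' := ⟨(contDiff_const : ContDiff ℝ ∞ fun _ : ℝ × Space d => (0 : ℝ)), ⟨0, fun _ _ _ => rfl⟩, fun _ => rfl⟩
  smul_mem' := by
    rintro a χ (h : IsSpaceTimeTest T χ)
    obtain ⟨R, hR⟩ := h.support
    exact ⟨h.contDiff.const_smul a, ⟨R, fun t x hx => by simp [hR t x hx]⟩,
      fun x => by simp [h.final]⟩

theorem integrable_bounded_mul {α : Type*} [MeasurableSpace α] {μ : Measure α} {v f : α → ℝ}
    {M : ℝ} (hv : AEStronglyMeasurable v μ) (hM : ∀ᵐ x ∂μ, |v x| ≤ M) (hf : Integrable f μ) :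
    Integrable (fun x => v x * f x) μ :=
  hf.bdd_mul hv hM

theorem abs_integral_mul_le {α : Type*} [MeasurableSpace α] {μ : Measure α} {v f : α → ℝ}
    {M : ℝ} (hM : ∀ᵐ x ∂μ, |v x| ≤ M) (hf : Integrable f μ) :
    |∫ x, v x * f x ∂μ| ≤ M * ∫ x, |f x| ∂μ := by
  rw [← integral_const_mul, ← Real.norm_eq_abs]
  refine norm_integral_le_of_norm_le (hf.abs.const_mul M) ?_
  filter_upwards [hM] with x hx
  rw [norm_mul]
  exact mul_le_mul_of_nonneg_right hx (abs_nonneg _)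

/-- Existence of a bounded solution of the transport equation in the sense of distributions. -/
theorem exists_distributional_solution (hT : 0 < T) (hc : IsLinftyLin T c)
    (hdiv : IsWeakDiv T c β)
    (hβ : MemLp (fun p : ℝ × Space d => β p.1 p.2) ⊤ (spaceTime d T)) {u₀ : Space d → ℝ} {M : ℝ}
    (hM0 : 0 ≤ M) (hu₀ : AEStronglyMeasurable u₀ volume) (hM : ∀ᵐ x, |u₀ x| ≤ M) :
    ∃ v : ℝ × Space d → ℝ, Measurable v ∧ (∀ p, |v p| ≤ M) ∧
      ∀ χ, IsSpaceTimeTest T χ →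
        -∫ x, u₀ x * χ (0, x) = ∫ p, v p * transportOp c β χ p ∂spaceTime d T := by
  have hu : ∀ χ : spaceTimeTestSubmodule d T, Integrable (fun x => u₀ x * χ.1 (0, x)) := fun χ =>
    integrable_bounded_mul hu₀ hM (IsSpaceTimeTest.slice χ.2 0).integrable
  let A : spaceTimeTestSubmodule d T →ₗ[ℝ] (ℝ × Space d → ℝ) :=
    { toFun := fun χ => transportOp c β χ.1
      map_add' := fun χ χ' => by
        funext p
        have h1 := (IsSpaceTimeTest.contDiff χ.2).differentiable (by simp) p
        have h2 := (IsSpaceTimeTest.contDiff χ'.2).differentiable (by simp) p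
        simp only [transportOp, Submodule.coe_add, Pi.add_apply, fderiv_add h1 h2,
          add_apply]
        ring
      map_smul' := fun a χ => by
        funext p
        have h1 := (IsSpaceTimeTest.contDiff χ.2).differentiable (by simp) p
        simp only [transportOp, Submodule.coe_smul, Pi.smul_apply, fderiv_const_smul h1,
          smul_apply, RingHom.id_apply, smul_eq_mul]
        ring }
  let l : spaceTimeTestSubmodule d T →ₗ[ℝ] ℝ :=
    { toFun := fun χ => -∫ x, u₀ x * χ.1 (0, x)
      map_add' := fun χ χ' => by
        rw [← neg_add, ← integral_add (hu χ) (hu χ')]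
        simp [mul_add]
      map_smul' := fun a χ => by
        rw [RingHom.id_apply, smul_eq_mul, mul_neg, ← integral_const_mul]
        congr 2; funext x
        simp; ring }
  -- The `L¹` estimate is the domination required for the duality argument, and the representing
  -- function satisfies the weak equation by construction.
  obtain ⟨v, hvm, hvM, hv⟩ := exists_bounded_repr (spaceTime d T) A
    (fun χ => IsSpaceTimeTest.integrable_transportOp χ.2 hc hβ) l hM0 fun χ => by
      have h1 : |l χ| ≤ M * ∫ x, |χ.1 (0, x)| := by
        change |-∫ x, u₀ x * χ.1 (0, x)| ≤ _
        rw [abs_neg]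
        exact abs_integral_mul_le hM (IsSpaceTimeTest.slice χ.2 0).integrable
      exact h1.trans (mul_le_mul_of_nonneg_left
        (IsSpaceTimeTest.integral_abs_le hT χ.2 hc hdiv hβ) hM0)
  exact ⟨v, hvm, hvM, fun χ hχ => hv ⟨χ, hχ⟩⟩

/-- A bound for the drift operator, uniform in the test function. -/
theorem exists_driftOp_bound (hc : IsLinftyLin T c)
    (hβ : MemLp (fun p : ℝ × Space d => β p.1 p.2) ⊤ (spaceTime d T)) :
    ∃ C : ℝ, 0 ≤ C ∧ ∀ᵐ p ∂spaceTime d T, ∀ φ : Space d → ℝ,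
      |driftOp c β p.1 φ p.2| ≤ C * (1 + ‖p.2‖) * (‖fderiv ℝ φ p.2‖ + |φ p.2|) := by
  obtain ⟨C, hC0, hC⟩ := hc.exists_bound
  obtain ⟨B, hB0, hB⟩ := exists_ae_bound hβ
  refine ⟨C + B, by positivity, ?_⟩
  filter_upwards [hC, hB] with p h1 h2 φ
  rw [driftOp_eq]
  refine (abs_add_le _ _).trans ?_
  have e1 : |fderiv ℝ φ p.2 (c p.1 p.2)| ≤ ‖fderiv ℝ φ p.2‖ * (C * (1 + ‖p.2‖)) :=
    ((fderiv ℝ φ p.2).le_opNorm _).trans (mul_le_mul_of_nonneg_left h1 (norm_nonneg _))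
  have e2 : |β p.1 p.2 * φ p.2| ≤ B * |φ p.2| := by
    rw [abs_mul]
    exact mul_le_mul_of_nonneg_right h2 (abs_nonneg _)
  have n1 := norm_nonneg p.2
  have n2 := norm_nonneg (fderiv ℝ φ p.2)
  have n3 := abs_nonneg (φ p.2)
  have p1 : 0 ≤ B * (1 + ‖p.2‖) * ‖fderiv ℝ φ p.2‖ := by positivity
  have p2 : 0 ≤ C * (1 + ‖p.2‖) * |φ p.2| := by positivity
  have p3 : 0 ≤ B * ‖p.2‖ * |φ p.2| := by positivity
  nlinarith

theorem aestronglyMeasurable_driftOp (hc : IsLinftyLin T c)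
    (hβ : MemLp (fun p : ℝ × Space d => β p.1 p.2) ⊤ (spaceTime d T)) {φ : Space d → ℝ}
    (hφ : IsTestFunction φ) :
    AEStronglyMeasurable (fun p : ℝ × Space d => driftOp c β p.1 φ p.2) (spaceTime d T) := by
  simp only [driftOp_eq]
  refine (aestronglyMeasurable_clm_apply ?_ hc.aestronglyMeasurable).add (hβ.1.mul ?_)
  · exact ((hφ.1.continuous_fderiv (by simp)).comp continuous_snd).aestronglyMeasurable
  · exact (hφ.continuous.comp continuous_snd).aestronglyMeasurable

theorem integrable_driftOp (hc : IsLinftyLin T c)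
    (hβ : MemLp (fun p : ℝ × Space d => β p.1 p.2) ⊤ (spaceTime d T)) {φ : Space d → ℝ}
    (hφ : IsTestFunction φ) :
    Integrable (fun p : ℝ × Space d => driftOp c β p.1 φ p.2) (spaceTime d T) := by
  obtain ⟨R, K, hR0, hK0, hK1, hK2, hR⟩ := hφ.exists_bound
  obtain ⟨C, hC0, hC⟩ := exists_driftOp_bound hc hβ
  refine integrable_of_bounded_of_cylinder (R := R) (K := C * (1 + R) * (K + K))
    (aestronglyMeasurable_driftOp hc hβ hφ) ?_ ?_
  · filter_upwards [hC] with p hp hpR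
    refine (hp φ).trans ?_
    gcongr
    exacts [hK2 _, hK1 _]
  · filter_upwards with p hp
    rw [driftOp_eq, (hR _ hp).1, (hR _ hp).2]
    simp

end WeakSolution

/-! ### The representative defined at every time -/

section DuBoisReymond

/-- The du Bois-Reymond lemma: a weak form of `f' = q`, `f 0 = a` gives `f = a + ∫ q` a.e. -/
theorem ae_eq_add_integral_of_weak {T : ℝ} (hT : 0 < T) {f q : ℝ → ℝ} {a : ℝ}
    (hf : IntegrableOn f (Set.Icc 0 T)) (hq : IntegrableOn q (Set.Icc 0 T))
    (h : ∀ θ : ℝ → ℝ, ContDiff ℝ ∞ θ → θ T = 0 →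
      -(a * θ 0) = ∫ t in Set.Icc 0 T, (deriv θ t * f t + θ t * q t)) :
    ∀ᵐ t ∂(volume.restrict (Set.Icc 0 T)), f t = a + ∫ s in (0 : ℝ)..t, q s := by
  have hqi : IntervalIntegrable q volume 0 T :=
    (intervalIntegrable_iff_integrableOn_Icc_of_le hT.le).2 hq
  have h0 : (0 : ℝ) ∈ Set.uIcc 0 T := Set.left_mem_uIcc
  set F : ℝ → ℝ := fun t => ∫ s in (0 : ℝ)..t, q s with hF
  have hFac : AbsolutelyContinuousOnInterval F 0 T :=
    hqi.absolutelyContinuousOnInterval_intervalIntegral h0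
  have hFc : ContinuousOn F (Set.Icc 0 T) := by
    have := hFac.continuousOn
    rwa [Set.uIcc_of_le hT.le] at this
  have hG : IntegrableOn (fun t => f t - F t - a) (Set.Icc 0 T) :=
    (hf.sub (hFc.integrableOn_compact isCompact_Icc)).sub
      (integrableOn_const (isCompact_Icc.measure_lt_top.ne))
  have key : ∀ᵐ t, (Set.Icc 0 T).indicator (fun t => f t - F t - a) t = 0 := by
    refine ae_eq_zero_of_integral_contDiff_smul_eq_zero
      (hG.integrable_indicator measurableSet_Icc).locallyIntegrable fun g hg _ => ?_
    have hgc : Continuous g := hg.continuous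
    -- The primitive of `g` vanishing at `T` is an admissible test function. Nothing is imposed at
    -- `0`, which is how the constant `a` is identified.
    set θ : ℝ → ℝ := fun t => ∫ s in T..t, g s with hθ
    have hθd : ∀ t, HasDerivAt θ (g t) t := fun t =>
      intervalIntegral.integral_hasDerivAt_right (hgc.intervalIntegrable _ _)
        hgc.aestronglyMeasurable.stronglyMeasurableAtFilter hgc.continuousAt
    have hθ' : deriv θ = g := funext fun t => (hθd t).deriv
    have hθs : ContDiff ℝ ∞ θ :=
      contDiff_infty_iff_deriv.2 ⟨fun t => (hθd t).differentiableAt, by rwa [hθ']⟩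
    have hθT : θ T = 0 := intervalIntegral.integral_same
    have hθ0 : θ 0 = -∫ s in (0 : ℝ)..T, g s := intervalIntegral.integral_symm _ _
    -- Since `q` is only integrable, its primitive is absolutely continuous and differentiable
    -- almost everywhere; integration by parts is used in that generality.
    have ibp := AbsolutelyContinuousOnInterval.integral_mul_deriv_eq_deriv_mul
      (hθs.of_le (mod_cast le_top)).contDiffOn.absolutelyContinuousOnInterval hFac
    have hF0 : F 0 = 0 := intervalIntegral.integral_same
    rw [hθT, hF0, hθ', zero_mul, mul_zero, sub_zero, zero_sub] at ibp
    have e1 : ∫ t in (0 : ℝ)..T, θ t * deriv F t = ∫ t in (0 : ℝ)..T, θ t * q t := by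
      refine intervalIntegral.integral_congr_ae ?_
      filter_upwards [hqi.ae_hasDerivAt_integral] with t ht hmem
      rw [(ht (Set.uIoc_subset_uIcc hmem) 0 h0).deriv]
    have hw := h θ hθs hθT
    rw [hθ'] at hw
    have hfi : IntervalIntegrable f volume 0 T :=
      (intervalIntegrable_iff_integrableOn_Icc_of_le hT.le).2 hf
    have i1 : IntervalIntegrable (fun t => g t * f t) volume 0 T :=
      hfi.continuousOn_mul hgc.continuousOn
    have i2 : IntervalIntegrable (fun t => θ t * q t) volume 0 T :=
      hqi.continuousOn_mul hθs.continuous.continuousOn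
    have i3 : IntervalIntegrable (fun t => g t * F t) volume 0 T :=
      ContinuousOn.intervalIntegrable (hgc.continuousOn.mul hFac.continuousOn)
    have i4 : IntervalIntegrable (fun t => g t * a) volume 0 T :=
      (hgc.mul continuous_const).intervalIntegrable _ _
    rw [integral_Icc_eq_integral_Ioc, ← intervalIntegral.integral_of_le hT.le,
      intervalIntegral.integral_add i1 i2, ← e1, ibp, hθ0] at hw
    have e2 : ∫ t, g t • (Set.Icc 0 T).indicator (fun t => f t - F t - a) t
        = ∫ t in (0 : ℝ)..T, (g t * f t - g t * F t - g t * a) := by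
      rw [intervalIntegral.integral_of_le hT.le, ← integral_Icc_eq_integral_Ioc,
        ← integral_indicator measurableSet_Icc]
      congr 1; funext t
      by_cases ht : t ∈ Set.Icc 0 T
      · rw [Set.indicator_of_mem ht, Set.indicator_of_mem ht, smul_eq_mul]; ring
      · rw [Set.indicator_of_notMem ht, Set.indicator_of_notMem ht, smul_zero]
    rw [e2, intervalIntegral.integral_sub (i1.sub i3) i4, intervalIntegral.integral_sub i1 i3,
      intervalIntegral.integral_mul_const]
    linarith
  rw [ae_restrict_iff' measurableSet_Icc]
  filter_upwards [key] with t ht hmem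
  rw [Set.indicator_of_mem hmem] at ht
  linarith

end DuBoisReymond

/-! ### A countable family of test functions that determines bounded functions. -/

section Separability

variable {d : ℕ}

/-- A sequence of test functions which is dense in the set of test functions for the `L¹`
distance. -/
theorem exists_dense_test_sequence (d : ℕ) :
    ∃ ψ : ℕ → Space d → ℝ, (∀ n, IsTestFunction (ψ n)) ∧
      ∀ φ, IsTestFunction φ → ∀ ε > 0, ∃ n, ∫ x, |φ x - ψ n x| < ε := by
  -- The image of the test functions is a subset of the separable metric space `L¹`, hence
  -- separable; a dense sequence of the image lifts to test functions.
  let ι : testSubmodule d → Lp ℝ 1 (volume : Measure (Space d)) := fun φ =>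
    (IsTestFunction.integrable φ.2).toL1
  have : Nonempty (Set.range ι) := ⟨⟨ι 0, Set.mem_range_self 0⟩⟩
  have : Fact ((1 : ℝ≥0∞) ≠ ⊤) := ⟨ENNReal.one_ne_top⟩
  choose ψ hψ using fun n => (TopologicalSpace.denseSeq (Set.range ι) n).2
  refine ⟨fun n => (ψ n).1, fun n => (ψ n).2, fun φ hφ ε hε => ?_⟩
  obtain ⟨n, hn⟩ := (TopologicalSpace.denseRange_denseSeq (Set.range ι)).exists_dist_lt
    ⟨ι ⟨φ, hφ⟩, Set.mem_range_self _⟩ hε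
  refine ⟨n, lt_of_le_of_lt (le_of_eq ?_) hn⟩
  rw [Subtype.dist_eq, ← hψ n, dist_eq_norm]
  change _ = ‖hφ.integrable.toL1 - (IsTestFunction.integrable (ψ n).2).toL1‖
  rw [← Integrable.toL1_sub, L1.norm_of_fun_eq_integral_norm]
  rfl

theorem pairing_sub_right {v φ ψ : Space d → ℝ} {M : ℝ} (hv : AEStronglyMeasurable v volume)
    (hM : ∀ᵐ x, |v x| ≤ M) (hφ : Integrable φ) (hψ : Integrable ψ) :
    pairing v φ - pairing v ψ = ∫ x, v x * (φ x - ψ x) := by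
  rw [pairing, pairing, ← integral_sub (integrable_bounded_mul hv hM hφ)
    (integrable_bounded_mul hv hM hψ)]
  simp only [mul_sub]

/-- Bounded functions with the same pairings with a dense sequence of test functions are equal. -/
theorem ae_eq_of_pairing_eq {ψ : ℕ → Space d → ℝ} (hψ : ∀ n, IsTestFunction (ψ n))
    (hdense : ∀ φ, IsTestFunction φ → ∀ ε > 0, ∃ n, ∫ x, |φ x - ψ n x| < ε)
    {v w : Space d → ℝ} {M : ℝ} (hv : AEStronglyMeasurable v volume)
    (hw : AEStronglyMeasurable w volume) (hvM : ∀ᵐ x, |v x| ≤ M) (hwM : ∀ᵐ x, |w x| ≤ M)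
    (h : ∀ n, pairing v (ψ n) = pairing w (ψ n)) : v =ᵐ[volume] w := by
  have hall : ∀ φ, IsTestFunction φ → pairing v φ = pairing w φ := by
    intro φ hφ
    have hM0 : 0 ≤ M := by
      obtain ⟨x, hx⟩ := hvM.exists
      exact (abs_nonneg _).trans hx
    refine eq_of_abs_sub_le_all fun ε hε => ?_
    -- Each of the two pairings contributes an error `M` times the `L¹` distance; the summand `1`
    -- covers `M = 0`.
    obtain ⟨n, hn⟩ := hdense φ hφ (ε / (2 * M + 1)) (by positivity)
    have hint := hφ.integrable.sub (hψ n).integrable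
    have e : pairing v φ - pairing w φ
        = (∫ x, v x * (φ x - ψ n x)) - ∫ x, w x * (φ x - ψ n x) := by
      rw [← pairing_sub_right hv hvM hφ.integrable (hψ n).integrable,
        ← pairing_sub_right hw hwM hφ.integrable (hψ n).integrable, h n]
      ring
    have h1 : |∫ x, v x * (φ x - ψ n x)| ≤ M * ∫ x, |φ x - ψ n x| := abs_integral_mul_le hvM hint
    have h2 : |∫ x, w x * (φ x - ψ n x)| ≤ M * ∫ x, |φ x - ψ n x| := abs_integral_mul_le hwM hint
    rw [e]
    rw [lt_div_iff₀ (by positivity)] at hn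
    have h3 : 0 ≤ ∫ x, |φ x - ψ n x| := integral_nonneg fun _ => abs_nonneg _
    refine (abs_sub _ _).trans ?_
    nlinarith
  have hloc : LocallyIntegrable (fun x => v x - w x) volume :=
    ((memLp_top_of_bound hv M hvM).sub (memLp_top_of_bound hw M hwM)).locallyIntegrable le_top
  have := ae_eq_zero_of_integral_contDiff_smul_eq_zero hloc fun g hg hgs => by
    have hg' : IsTestFunction g := ⟨hg, hgs⟩
    have := hall g hg'
    rw [← sub_eq_zero, pairing, pairing, ← integral_sub (integrable_bounded_mul hv hvM
      hg'.integrable) (integrable_bounded_mul hw hwM hg'.integrable)] at this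
    rw [← this]
    congr 1; funext x
    rw [smul_eq_mul]; ring
  filter_upwards [this] with x hx
  linarith

end Separability

/-! ### From a distributional solution to slices at every time. -/

section Existence

variable {d : ℕ} {T : ℝ} {c : ℝ → Space d → Space d} {β : ℝ → Space d → ℝ}

theorem isSpaceTimeTest_mul {θ : ℝ → ℝ} (hθ : ContDiff ℝ ∞ θ) (hθT : θ T = 0) {φ : Space d → ℝ}
    (hφ : IsTestFunction φ) : IsSpaceTimeTest T (fun p : ℝ × Space d => θ p.1 * φ p.2) := by
  obtain ⟨R, K, -, -, -, -, hR⟩ := hφ.exists_bound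
  exact ⟨(hθ.comp contDiff_fst).mul (hφ.1.comp contDiff_snd),
    ⟨R, fun t x hx => by simp [(hR x hx).1]⟩, fun x => by simp [hθT]⟩

theorem transportOp_mul {θ : ℝ → ℝ} (hθ : ContDiff ℝ ∞ θ) {φ : Space d → ℝ}
    (hφ : IsTestFunction φ) (p : ℝ × Space d) :
    transportOp c β (fun p : ℝ × Space d => θ p.1 * φ p.2) p
      = deriv θ p.1 * φ p.2 + θ p.1 * driftOp c β p.1 φ p.2 := by
  have h0 : HasFDerivAt (Prod.fst : ℝ × Space d → ℝ) (ContinuousLinearMap.fst ℝ ℝ (Space d)) p :=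
    hasFDerivAt_fst
  have h1 : HasFDerivAt (fun p : ℝ × Space d => θ p.1) _ p :=
    (hθ.differentiable (by simp) p.1).hasDerivAt.comp_hasFDerivAt p h0
  have h2 : HasFDerivAt (fun p : ℝ × Space d => φ p.2) _ p :=
    (hφ.1.differentiable (by simp) p.2).hasFDerivAt.comp p hasFDerivAt_snd
  have h3 : HasFDerivAt (fun p : ℝ × Space d => θ p.1 * φ p.2) _ p := h1.mul h2
  rw [transportOp, h3.fderiv, driftOp_eq]
  simp
  ring

/-- A distributional solution solves the equation in integrated form at almost every time. -/
theorem ae_pairing_eq_of_distributional (hT : 0 < T) (hc : IsLinftyLin T c)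
    (hβ : MemLp (fun p : ℝ × Space d => β p.1 p.2) ⊤ (spaceTime d T)) {u₀ : Space d → ℝ} {M : ℝ}
    {v : ℝ × Space d → ℝ} (hvm : Measurable v) (hvM : ∀ p, |v p| ≤ M)
    (hv : ∀ χ, IsSpaceTimeTest T χ →
        -∫ x, u₀ x * χ (0, x) = ∫ p, v p * transportOp c β χ p ∂spaceTime d T)
    {φ : Space d → ℝ} (hφ : IsTestFunction φ) :
    ∀ᵐ t ∂(volume.restrict (Set.Icc 0 T)), pairing (fun x => v (t, x)) φ
      = pairing u₀ φ + ∫ s in (0 : ℝ)..t, pairing (fun x => v (s, x)) (driftOp c β s φ) := by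
  have i1 : Integrable (fun p : ℝ × Space d => v p * φ p.2) (spaceTime d T) :=
    integrable_bounded_mul hvm.aestronglyMeasurable (ae_of_all _ hvM) (hφ.integrable.comp_snd _)
  have i2 : Integrable (fun p : ℝ × Space d => v p * driftOp c β p.1 φ p.2) (spaceTime d T) :=
    integrable_bounded_mul hvm.aestronglyMeasurable (ae_of_all _ hvM)
      (integrable_driftOp hc hβ hφ)
  refine ae_eq_add_integral_of_weak hT i1.integral_prod_left i2.integral_prod_left
    fun θ hθ hθT => ?_
  -- Testing with the products `θ(t) φ(x)` reduces the equation to a scalar weak differential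
  -- equation for the pairing with `φ`.
  have h1 := hv _ (isSpaceTimeTest_mul hθ hθT hφ)
  simp only [transportOp_mul hθ hφ] at h1
  have e1 : ∫ x, u₀ x * (θ 0 * φ x) = pairing u₀ φ * θ 0 := by
    rw [pairing, ← integral_mul_const]
    congr 1; funext x; ring
  rw [e1] at h1
  rw [h1]
  have j1 : Integrable (fun p : ℝ × Space d => deriv θ p.1 * (v p * φ p.2)) (spaceTime d T) := by
    obtain ⟨K, hK⟩ := (isCompact_Icc (a := (0 : ℝ)) (b := T)).exists_bound_of_continuousOn
      (hθ.continuous_deriv (by simp)).continuousOn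
    refine integrable_bounded_mul (M := K) ((hθ.continuous_deriv (by simp)).comp
      continuous_fst).aestronglyMeasurable ?_ i1
    filter_upwards [spaceTime_ae_mem d T] with p hp
    exact hK _ hp
  have j2 : Integrable (fun p : ℝ × Space d => θ p.1 * (v p * driftOp c β p.1 φ p.2))
      (spaceTime d T) := by
    obtain ⟨K, hK⟩ := (isCompact_Icc (a := (0 : ℝ)) (b := T)).exists_bound_of_continuousOn
      hθ.continuous.continuousOn
    refine integrable_bounded_mul (M := K) (hθ.continuous.comp
      continuous_fst).aestronglyMeasurable ?_ i2
    filter_upwards [spaceTime_ae_mem d T] with p hp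
    exact hK _ hp
  have e2 : ∀ p : ℝ × Space d,
      v p * (deriv θ p.1 * φ p.2 + θ p.1 * driftOp c β p.1 φ p.2)
        = deriv θ p.1 * (v p * φ p.2) + θ p.1 * (v p * driftOp c β p.1 φ p.2) := fun p => by ring
  simp only [e2]
  rw [spaceTime] at j1 j2 ⊢
  have j12 : Integrable (fun p : ℝ × Space d => deriv θ p.1 * (v p * φ p.2)
      + θ p.1 * (v p * driftOp c β p.1 φ p.2)) ((volume.restrict (Set.Icc 0 T)).prod volume) :=
    j1.add j2
  rw [integral_prod _ j12]
  refine integral_congr_ae ?_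
  filter_upwards [j1.prod_right_ae, j2.prod_right_ae] with t k1 k2
  rw [pairing, pairing, ← integral_const_mul, ← integral_const_mul]
  exact integral_add k1 k2

/-- Existence of a bounded solution of the transport equation, defined at every time. -/
theorem exists_transport_solution (hT : 0 < T) (hc : IsLinftyLin T c) (hdiv : IsWeakDiv T c β)
    (hβ : MemLp (fun p : ℝ × Space d => β p.1 p.2) ⊤ (spaceTime d T)) {u₀ : Space d → ℝ}
    (hu₀ : MemLp u₀ ⊤ volume) :
    ∃ (M : ℝ) (w : ℝ → Space d → ℝ),
      AEStronglyMeasurable (fun p : ℝ × Space d => w p.1 p.2) (spaceTime d T) ∧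
      (∀ t, Measurable (w t)) ∧ (∀ t x, |w t x| ≤ M) ∧
      ∀ φ, IsTestFunction φ →
        IntegrableOn (fun s => pairing (w s) (driftOp c β s φ)) (Set.Icc 0 T) ∧
        ∀ t ∈ Set.Icc 0 T, pairing (w t) φ
          = pairing u₀ φ + ∫ s in (0 : ℝ)..t, pairing (w s) (driftOp c β s φ) := by
  obtain ⟨M, hM0, hM⟩ := exists_ae_bound hu₀
  obtain ⟨v, hvm, hvM, hv⟩ := exists_distributional_solution hT hc hdiv hβ hM0 hu₀.1 hM
  obtain ⟨ψ, hψ, hdense⟩ := exists_dense_test_sequence d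
  have hvt : ∀ t, Measurable fun x => v (t, x) := fun t => hvm.comp (by fun_prop)
  have i2 : ∀ φ, IsTestFunction φ →
      Integrable (fun p : ℝ × Space d => v p * driftOp c β p.1 φ p.2) (spaceTime d T) := fun φ hφ =>
    integrable_bounded_mul hvm.aestronglyMeasurable (ae_of_all _ hvM) (integrable_driftOp hc hβ hφ)
  set q : (Space d → ℝ) → ℝ → ℝ := fun φ s => pairing (fun x => v (s, x)) (driftOp c β s φ) with hq
  have hqi : ∀ φ, IsTestFunction φ → IntegrableOn (q φ) (Set.Icc 0 T) := fun φ hφ =>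
    (i2 φ hφ).integral_prod_left
  have hqii : ∀ φ, IsTestFunction φ → ∀ t ∈ Set.Icc 0 T, IntervalIntegrable (q φ) volume 0 t :=
    fun φ hφ t ht => (intervalIntegrable_iff_integrableOn_Icc_of_le ht.1).2
      ((hqi φ hφ).mono_set (Set.Icc_subset_Icc_right ht.2))
  -- `F φ` is the continuous version in time of the pairing with `φ`, and is meaningful at every
  -- time.
  set F : (Space d → ℝ) → ℝ → ℝ := fun φ t => pairing u₀ φ + ∫ s in (0 : ℝ)..t, q φ s with hF
  have hFae : ∀ φ, IsTestFunction φ → ∀ᵐ t ∂(volume.restrict (Set.Icc 0 T)),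
      pairing (fun x => v (t, x)) φ = F φ t := fun φ hφ =>
    ae_pairing_eq_of_distributional hT hc hβ hvm hvM hv hφ
  have hFb : ∀ φ, IsTestFunction φ → ∀ t ∈ Set.Icc 0 T, |F φ t| ≤ M * ∫ x, |φ x| := by
    intro φ hφ
    have hFc : ContinuousOn (F φ) (Set.Icc 0 T) := by
      refine continuousOn_const.add ?_
      have := intervalIntegral.continuousOn_primitive_interval (a := 0) (b := T)
        (by rw [Set.uIcc_of_le hT.le]; exact hqi φ hφ)
      rwa [Set.uIcc_of_le hT.le] at this
    -- Writing the inequality as `max |F φ t| K = K` turns it into an equality of continuous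
    -- functions, which passes from almost every time to every time.
    have := Measure.eqOn_Icc_of_ae_eq (μ := volume) hT.ne
      (f := fun t => max |F φ t| (M * ∫ x, |φ x|)) (g := fun _ => M * ∫ x, |φ x|) (by
        filter_upwards [hFae φ hφ] with t ht
        refine max_eq_right ?_
        rw [← ht]
        exact abs_integral_mul_le (ae_of_all _ fun x => hvM _) hφ.integrable)
      (hFc.abs.sup continuousOn_const) continuousOn_const
    intro t ht
    exact max_eq_right_iff.1 (this ht)
  -- At a fixed time `φ ↦ F φ t` is linear and bounded by `M` in the `L¹` norm, so duality provides
  -- a slice.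
  have hslice : ∀ t ∈ Set.Icc 0 T, ∃ w : Space d → ℝ, Measurable w ∧ (∀ x, |w x| ≤ M) ∧
      ∀ φ, IsTestFunction φ → F φ t = pairing w φ := by
    intro t ht
    have hu : ∀ φ, IsTestFunction φ → Integrable (fun x => u₀ x * φ x) := fun φ hφ =>
      integrable_bounded_mul hu₀.1 hM hφ.integrable
    let l : testSubmodule d →ₗ[ℝ] ℝ :=
      { toFun := fun φ => F φ.1 t
        map_add' := fun φ φ' => by
          have e1 : pairing u₀ (φ.1 + φ'.1) = pairing u₀ φ.1 + pairing u₀ φ'.1 := by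
            rw [pairing, pairing, pairing, ← integral_add (hu _ φ.2) (hu _ φ'.2)]
            simp [mul_add]
          have e2 : ∫ s in (0 : ℝ)..t, q (φ.1 + φ'.1) s
              = (∫ s in (0 : ℝ)..t, q φ.1 s) + ∫ s in (0 : ℝ)..t, q φ'.1 s := by
            rw [← intervalIntegral.integral_add (hqii _ φ.2 t ht) (hqii _ φ'.2 t ht),
              intervalIntegral.integral_of_le ht.1, intervalIntegral.integral_of_le ht.1]
            refine integral_congr_ae (ae_restrict_of_ae_restrict_of_subset
              (Set.Ioc_subset_Icc_self.trans (Set.Icc_subset_Icc_right ht.2)) ?_)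
            filter_upwards [(i2 _ φ.2).prod_right_ae, (i2 _ φ'.2).prod_right_ae] with s k1 k2
            simp only [hq, pairing]
            rw [← integral_add k1 k2]
            congr 1; funext x
            simp only [driftOp, partialDeriv_add φ.2 φ'.2, mul_add, Finset.sum_add_distrib,
              Pi.add_apply]
            ring
          simp only [hF, Submodule.coe_add, e1, e2]
          ring
        map_smul' := fun a φ => by
          have e1 : pairing u₀ (a • φ.1) = a * pairing u₀ φ.1 := by
            rw [pairing, pairing, ← integral_const_mul]
            congr 1; funext x; simp; ring
          have e2 : ∀ s, q (a • φ.1) s = a * q φ.1 s := fun s => by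
            simp only [hq, pairing]
            rw [← integral_const_mul]
            congr 1; funext x
            simp only [driftOp, partialDeriv_smul φ.2, Pi.smul_apply, smul_eq_mul]
            rw [Finset.sum_congr rfl fun i _ => mul_left_comm (c s x i) a _, ← Finset.mul_sum]
            ring
          simp only [hF, Submodule.coe_smul, e1, e2, RingHom.id_apply, smul_eq_mul,
            intervalIntegral.integral_const_mul]
          ring }
    obtain ⟨w, hwm, hwM, hw⟩ := exists_bounded_repr volume (testSubmodule d).subtype
      (fun φ => IsTestFunction.integrable φ.2) l hM0 fun φ => hFb φ.1 φ.2 t ht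
    exact ⟨w, hwm, hwM, fun φ hφ => hw ⟨φ, hφ⟩⟩
  choose! w' hw'm hw'M hw' using hslice
  classical
  -- The slices `w' t` are chosen separately for each time, so they carry no joint measurability.
  -- They therefore replace those of `v` only on this set, which is null because the family `ψ` is
  -- countable.
  set bad : Set ℝ := {t | t ∈ Set.Icc 0 T ∧ ¬∀ n, pairing (fun x => v (t, x)) (ψ n) = F (ψ n) t}
    with hbad
  set w : ℝ → Space d → ℝ := fun t => if t ∈ bad then w' t else fun x => v (t, x) with hw
  have hgood : ∀ᵐ t ∂(volume.restrict (Set.Icc 0 T)), t ∉ bad := by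
    filter_upwards [ae_all_iff.2 fun n => hFae (ψ n) (hψ n)] with t ht hb
    exact hb.2 ht
  have hwv : ∀ t, t ∉ bad → w t = fun x => v (t, x) := fun t ht => if_neg ht
  have hww' : ∀ t ∈ bad, w t = w' t := fun t ht => if_pos ht
  have hqw : ∀ φ, q φ =ᵐ[volume.restrict (Set.Icc 0 T)]
      fun s => pairing (w s) (driftOp c β s φ) := fun φ => by
    filter_upwards [hgood] with s hs
    rw [hwv s hs]
  refine ⟨M, w, ?_, fun t => ?_, fun t x => ?_, fun φ hφ => ⟨(hqi φ hφ).congr (hqw φ),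
    fun t ht => ?_⟩⟩
  · refine hvm.aestronglyMeasurable.congr ?_
    filter_upwards [Measure.quasiMeasurePreserving_fst.ae hgood] with p hp
    rw [hwv _ hp]
  · by_cases ht : t ∈ bad
    · rw [hww' t ht]; exact hw'm t ht.1
    · rw [hwv t ht]; exact hvt t
  · by_cases ht : t ∈ bad
    · rw [hww' t ht]; exact hw'M t ht.1 x
    · rw [hwv t ht]; exact hvM _
  · have e1 : pairing (w t) φ = F φ t := by
      by_cases hb : t ∈ bad
      · rw [hww' t hb, hw' t ht φ hφ]
      · have hb' : ∀ n, pairing (fun x => v (t, x)) (ψ n) = F (ψ n) t := by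
          by_contra hne
          exact hb ⟨ht, hne⟩
        have := ae_eq_of_pairing_eq hψ hdense (hvt t).aestronglyMeasurable
          (hw'm t ht).aestronglyMeasurable (ae_of_all _ fun x => hvM _)
          (ae_of_all _ fun x => hw'M t ht x) fun n => by rw [hb' n, hw' t ht _ (hψ n)]
        rw [hwv t hb, hw' t ht φ hφ]
        refine integral_congr_ae ?_
        filter_upwards [this] with x hx
        rw [hx]
    rw [e1]
    simp only [hF]
    congr 1
    rw [intervalIntegral.integral_of_le ht.1, intervalIntegral.integral_of_le ht.1]
    exact integral_congr_ae (ae_restrict_of_ae_restrict_of_subset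
      (Set.Ioc_subset_Icc_self.trans (Set.Icc_subset_Icc_right ht.2)) (hqw φ))

end Existence

/-! ### Pairings with translated test functions -/

section Shift

variable {d : ℕ} {T : ℝ}

/-- The pairing of `v` with the translate of `φ` by `z`. -/
noncomputable def shiftPairing (v φ : Space d → ℝ) (z : Space d) : ℝ :=
  pairing v (fun x => φ (x + z))

/-- A measurable function bounded by `M`. -/
structure IsBoundedBy (M : ℝ) (v : Space d → ℝ) : Prop where
  measurable : Measurable v
  bound : ∀ x, |v x| ≤ M

variable {M : ℝ} {v φ : Space d → ℝ}

theorem IsBoundedBy.nonneg (hv : IsBoundedBy M v) : 0 ≤ M := (abs_nonneg _).trans (hv.bound 0)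

theorem IsBoundedBy.integrable_mul (hv : IsBoundedBy M v) {f : Space d → ℝ} (hf : Integrable f) :
    Integrable (fun x => v x * f x) :=
  integrable_bounded_mul hv.measurable.aestronglyMeasurable (ae_of_all _ hv.bound) hf

theorem IsBoundedBy.abs_pairing_le (hv : IsBoundedBy M v) {f : Space d → ℝ} (hf : Integrable f) :
    |pairing v f| ≤ M * ∫ x, |f x| :=
  abs_integral_mul_le (ae_of_all _ hv.bound) hf

theorem IsBoundedBy.abs_shiftPairing_le (hv : IsBoundedBy M v) (hφ : IsTestFunction φ)
    (z : Space d) : |shiftPairing v φ z| ≤ M * ∫ x, |φ x| := by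
  refine (hv.abs_pairing_le (hφ.translate z).integrable).trans (le_of_eq ?_)
  rw [integral_add_right_eq_self (fun x => |φ x|)]

/-- All derivatives fall on the test function, so no regularity of `v` enters. The translates for
parameters near `θ` have their supports in one common ball, which gives the domination. -/
theorem IsBoundedBy.hasDerivAt_shiftPairing (hv : IsBoundedBy M v) (hφ : IsTestFunction φ)
    (z h : Space d) (θ : ℝ) : HasDerivAt (fun θ : ℝ => shiftPairing v φ (z + θ • h))
      (∑ i, h i * shiftPairing v (partialDeriv i φ) (z + θ • h)) θ := by
  obtain ⟨R, K, hR0, hK0, hK1, hK2, hR⟩ := hφ.exists_bound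
  set R' := R + ‖z‖ + (|θ| + 1) * ‖h‖ with hR'
  have key := hasDerivAt_integral_of_dominated_loc_of_deriv_le (μ := (volume : Measure (Space d)))
    (F := fun θ x => v x * φ (x + (z + θ • h)))
    (F' := fun θ x => v x * fderiv ℝ φ (x + (z + θ • h)) h) (x₀ := θ) (s := Metric.ball θ 1)
    (bound := (Metric.closedBall (0 : Space d) R').indicator fun _ => M * (K * ‖h‖))
    (Metric.ball_mem_nhds θ one_pos)
    (Eventually.of_forall fun θ' =>
      (hv.integrable_mul (hφ.translate (z + θ' • h)).integrable).aestronglyMeasurable)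
    (hv.integrable_mul (hφ.translate (z + θ • h)).integrable) ?_ ?_ ?_ ?_
  · have e : ∑ i, h i * shiftPairing v (partialDeriv i φ) (z + θ • h)
        = ∫ x, v x * fderiv ℝ φ (x + (z + θ • h)) h := by
      simp only [shiftPairing, pairing, ← integral_const_mul]
      rw [← integral_finsetSum _ fun i _ =>
        (hv.integrable_mul ((hφ.partialDeriv i).translate (z + θ • h)).integrable).const_mul _]
      congr 1; funext x
      rw [fderiv_apply_eq_sum, Finset.mul_sum]
      exact Finset.sum_congr rfl fun i _ => by ring
    rw [e]
    exact key.2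
  · refine hv.measurable.aestronglyMeasurable.mul (Continuous.aestronglyMeasurable ?_)
    have := hφ.1.continuous_fderiv (by simp)
    fun_prop
  · refine ae_of_all _ fun x θ' hθ' => ?_
    have hθ1 : |θ'| ≤ |θ| + 1 := by
      rw [Metric.mem_ball, Real.dist_eq] at hθ'
      have := abs_sub_abs_le_abs_sub θ' θ
      linarith
    by_cases hx : x ∈ Metric.closedBall (0 : Space d) R'
    · rw [Set.indicator_of_mem hx, norm_mul]
      refine mul_le_mul (hv.bound x) ?_ (norm_nonneg _) hv.nonneg
      exact ((fderiv ℝ φ _).le_opNorm h).trans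
        (mul_le_mul_of_nonneg_right (hK2 _) (norm_nonneg _))
    · rw [Set.indicator_of_notMem hx]
      rw [mem_closedBall_zero_iff, not_le] at hx
      have h1 : R < ‖x + (z + θ' • h)‖ := by
        have e1 : ‖x‖ ≤ ‖x + (z + θ' • h)‖ + ‖z + θ' • h‖ := by
          simpa using norm_sub_le (x + (z + θ' • h)) (z + θ' • h)
        have e2 : ‖z + θ' • h‖ ≤ ‖z‖ + (|θ| + 1) * ‖h‖ := by
          refine (norm_add_le _ _).trans (add_le_add le_rfl ?_)
          rw [norm_smul, Real.norm_eq_abs]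
          exact mul_le_mul_of_nonneg_right hθ1 (norm_nonneg _)
        linarith
      rw [(hR _ h1).2]
      simp
  · exact (integrable_indicator_iff measurableSet_closedBall).2
      (integrableOn_const (measure_closedBall_lt_top).ne)
  · refine ae_of_all _ fun x θ' _ => HasDerivAt.const_mul _ ?_
    have h1 : HasDerivAt (fun θ : ℝ => x + (z + θ • h)) h θ' := by
      have := ((hasDerivAt_id θ').smul_const h).const_add z |>.const_add x
      simpa using this
    exact (hφ.1.differentiable (by simp) _).hasFDerivAt.comp_hasDerivAt θ' h1

theorem abs_apply_le_norm (h : Space d) (i : Fin d) : |h i| ≤ ‖h‖ := by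
  simpa using PiLp.norm_apply_le h i

theorem abs_sub_le_of_abs_deriv_le {G G' : ℝ → ℝ} {B : ℝ} (hG : ∀ θ, HasDerivAt G (G' θ) θ)
    (hB : ∀ θ, 0 ≤ θ → θ ≤ 1 → |G' θ| ≤ B) : |G 1 - G 0| ≤ B :=
  norm_image_sub_le_of_norm_deriv_le_segment_01' (fun θ _ => (hG θ).hasDerivWithinAt)
    fun θ hθ => hB θ hθ.1 hθ.2.le

theorem abs_sum_mul_le {h : Space d} {a B : Fin d → ℝ} {D : ℝ} (ha : ∀ i, |a i| ≤ B i * D) :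
    |∑ i, h i * a i| ≤ (∑ i, B i) * (‖h‖ * D) := by
  rw [Finset.sum_mul]
  refine (Finset.abs_sum_le_sum_abs _ _).trans (Finset.sum_le_sum fun i _ => ?_)
  rw [abs_mul]
  calc |h i| * |a i| ≤ ‖h‖ * (B i * D) :=
        mul_le_mul (abs_apply_le_norm h i) (ha i) (abs_nonneg _) (norm_nonneg _)
    _ = B i * (‖h‖ * D) := by ring

/-- First-order Taylor estimate. -/
theorem exists_taylor_one (M : ℝ) (hφ : IsTestFunction φ) :
    ∃ C : ℝ, ∀ v, IsBoundedBy M v → ∀ z h : Space d,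
      |shiftPairing v φ (z + h) - shiftPairing v φ z| ≤ C * ‖h‖ := by
  refine ⟨∑ i, M * ∫ x, |partialDeriv i φ x|, fun v hv z h => ?_⟩
  have := abs_sub_le_of_abs_deriv_le (hv.hasDerivAt_shiftPairing hφ z h)
    (B := (∑ i, M * ∫ x, |partialDeriv i φ x|) * (‖h‖ * 1)) fun θ _ _ =>
    abs_sum_mul_le fun i => by
      rw [mul_one]
      exact hv.abs_shiftPairing_le (hφ.partialDeriv i) _
  simpa using this

/-- Second-order Taylor estimate. -/
theorem exists_taylor_two (M : ℝ) (hφ : IsTestFunction φ) :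
    ∃ C : ℝ, ∀ v, IsBoundedBy M v → ∀ z h : Space d,
      |shiftPairing v φ (z + h) - shiftPairing v φ z
        - ∑ i, h i * shiftPairing v (partialDeriv i φ) z| ≤ C * ‖h‖ ^ 2 := by
  choose C hC using fun i => exists_taylor_one M (hφ.partialDeriv i)
  refine ⟨∑ i, |C i|, fun v hv z h => ?_⟩
  -- After subtraction of the linear part, the derivative in `θ` is a sum of zeroth-order Taylor
  -- remainders of the partial derivatives at step `θ • h`, controlled by `exists_taylor_one`.
  have hd : ∀ θ : ℝ, HasDerivAt (fun θ : ℝ => shiftPairing v φ (z + θ • h)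
      - θ * ∑ i, h i * shiftPairing v (partialDeriv i φ) z)
      (∑ i, h i * (shiftPairing v (partialDeriv i φ) (z + θ • h)
        - shiftPairing v (partialDeriv i φ) z)) θ := fun θ => by
    refine ((hv.hasDerivAt_shiftPairing hφ z h θ).sub
      ((hasDerivAt_id θ).mul_const _)).congr_deriv ?_
    rw [one_mul, ← Finset.sum_sub_distrib]
    exact Finset.sum_congr rfl fun i _ => by ring
  have := abs_sub_le_of_abs_deriv_le hd (B := (∑ i, |C i|) * (‖h‖ * ‖h‖)) fun θ h0 h1 =>
    abs_sum_mul_le fun i => by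
      refine (hC i v hv z (θ • h)).trans ?_
      rw [norm_smul, Real.norm_eq_abs, abs_of_nonneg h0]
      refine mul_le_mul (le_abs_self _) ?_ (by positivity) (abs_nonneg _)
      exact mul_le_of_le_one_left (norm_nonneg _) h1
  rw [← pow_two] at this
  refine le_trans (le_of_eq ?_) this
  congr 1
  simp
  ring

/-- Third-order Taylor estimate. -/
theorem exists_taylor_three (M : ℝ) (hφ : IsTestFunction φ) :
    ∃ C : ℝ, ∀ v, IsBoundedBy M v → ∀ z h : Space d,
      |shiftPairing v φ (z + h) - shiftPairing v φ z
        - (∑ i, h i * shiftPairing v (partialDeriv i φ) z)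
        - 1 / 2 * ∑ i, h i * ∑ j, h j * shiftPairing v (partialDeriv j (partialDeriv i φ)) z|
        ≤ C * ‖h‖ ^ 3 := by
  choose C hC using fun i => exists_taylor_two M (hφ.partialDeriv i)
  refine ⟨∑ i, |C i|, fun v hv z h => ?_⟩
  -- The same device one order higher: the derivative is a sum of the remainders estimated in
  -- `exists_taylor_two`.
  have hd : ∀ θ : ℝ, HasDerivAt (fun θ : ℝ => shiftPairing v φ (z + θ • h)
      - θ * (∑ i, h i * shiftPairing v (partialDeriv i φ) z)
      - θ ^ 2 * (1 / 2 * ∑ i, h i * ∑ j, h j *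
        shiftPairing v (partialDeriv j (partialDeriv i φ)) z))
      (∑ i, h i * (shiftPairing v (partialDeriv i φ) (z + θ • h)
        - shiftPairing v (partialDeriv i φ) z
        - ∑ j, (θ • h) j * shiftPairing v (partialDeriv j (partialDeriv i φ)) z)) θ := fun θ => by
    refine (((hv.hasDerivAt_shiftPairing hφ z h θ).sub
      ((hasDerivAt_id θ).mul_const _)).sub ((hasDerivAt_pow 2 θ).mul_const _)).congr_deriv ?_
    have e : ∀ i, ∑ j, (θ • h) j * shiftPairing v (partialDeriv j (partialDeriv i φ)) z
        = θ * ∑ j, h j * shiftPairing v (partialDeriv j (partialDeriv i φ)) z := fun i => by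
      rw [Finset.mul_sum]
      exact Finset.sum_congr rfl fun j _ => by simp [mul_assoc]
    have e2 : ((2 : ℕ) : ℝ) * θ ^ (2 - 1) * (1 / 2 * ∑ i, h i * ∑ j, h j *
        shiftPairing v (partialDeriv j (partialDeriv i φ)) z)
        = ∑ i, h i * (θ * ∑ j, h j * shiftPairing v (partialDeriv j (partialDeriv i φ)) z) := by
      rw [Finset.sum_congr rfl fun i _ => mul_left_comm (h i) θ _, ← Finset.mul_sum]
      norm_num
      ring
    rw [e2, one_mul, ← Finset.sum_sub_distrib, ← Finset.sum_sub_distrib]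
    exact Finset.sum_congr rfl fun i _ => by rw [e]; ring
  have := abs_sub_le_of_abs_deriv_le hd (B := (∑ i, |C i|) * (‖h‖ * ‖h‖ ^ 2)) fun θ h0 h1 =>
    abs_sum_mul_le fun i => by
      refine (hC i v hv z (θ • h)).trans ?_
      rw [norm_smul, Real.norm_eq_abs, abs_of_nonneg h0]
      refine mul_le_mul (le_abs_self _) ?_ (by positivity) (abs_nonneg _)
      exact pow_le_pow_left₀ (by positivity) (mul_le_of_le_one_left (norm_nonneg _) h1) 2
  rw [← pow_succ'] at this
  refine le_trans (le_of_eq ?_) this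
  congr 1
  simp
  ring

end Shift

/-! ### Dependence of the drift term on the translation. -/

section DriftShift

variable {d : ℕ} {T : ℝ} {c : ℝ → Space d → Space d} {β : ℝ → Space d → ℝ}

theorem IsTestFunction.exists_lipschitz {φ : Space d → ℝ} (h : IsTestFunction φ) :
    ∃ K : ℝ, 0 ≤ K ∧ ∀ x y, |φ x - φ y| ≤ K * ‖x - y‖ ∧
      ‖fderiv ℝ φ x - fderiv ℝ φ y‖ ≤ K * ‖x - y‖ := by
  obtain ⟨K₁, hK₁⟩ := h.1.lipschitzWith_of_hasCompactSupport h.2 (by simp)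
  obtain ⟨K₂, hK₂⟩ := (h.1.fderiv_right (m := ∞) (by simp)).lipschitzWith_of_hasCompactSupport
    (h.2.fderiv (𝕜 := ℝ)) (by simp)
  refine ⟨max K₁ K₂, le_max_of_le_left K₁.2, fun x y => ⟨?_, ?_⟩⟩
  · exact (hK₁.norm_sub_le x y).trans
      (mul_le_mul_of_nonneg_right (le_max_left _ _) (norm_nonneg _))
  · exact (hK₂.norm_sub_le x y).trans
      (mul_le_mul_of_nonneg_right (le_max_right _ _) (norm_nonneg _))

theorem driftOp_sub {φ ψ : Space d → ℝ} (hφ : IsTestFunction φ) (hψ : IsTestFunction ψ) (t : ℝ)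
    (x : Space d) : driftOp c β t φ x - driftOp c β t ψ x = driftOp c β t (φ - ψ) x := by
  rw [driftOp_eq, driftOp_eq, driftOp_eq, fderiv_sub (hφ.1.differentiable (by simp) x)
    (hψ.1.differentiable (by simp) x)]
  simp
  ring

/-- Bounds for the drift of translated test functions, and its dependence on the translation. -/
theorem exists_drift_shift_bound (hc : IsLinftyLin T c)
    (hβ : MemLp (fun p : ℝ × Space d => β p.1 p.2) ⊤ (spaceTime d T)) {φ : Space d → ℝ}
    (hφ : IsTestFunction φ) (M ρ : ℝ) (hρ : 0 ≤ ρ) :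
    ∃ C : ℝ, 0 ≤ C ∧ ∀ᵐ r ∂(volume.restrict (Set.Icc 0 T)), ∀ v, IsBoundedBy M v →
      ∀ z z' : Space d, ‖z‖ ≤ ρ → ‖z'‖ ≤ ρ →
        |pairing v (driftOp c β r fun x => φ (x + z))| ≤ C ∧
        |pairing v (driftOp c β r fun x => φ (x + z))
          - pairing v (driftOp c β r fun x => φ (x + z'))| ≤ C * ‖z - z'‖ := by
  obtain ⟨R, K, hR0, hK0, hK1, hK2, hR⟩ := hφ.exists_bound
  obtain ⟨L, hL0, hL⟩ := hφ.exists_lipschitz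
  obtain ⟨C, hC0, hC⟩ := exists_driftOp_bound hc hβ
  set ind : Space d → ℝ := (Metric.closedBall (0 : Space d) (R + ρ)).indicator fun _ => 1 with hind
  have hind0 : ∀ x, 0 ≤ ind x := fun x => Set.indicator_nonneg (fun _ _ => zero_le_one) x
  have iV : Integrable ind := (integrable_indicator_iff measurableSet_closedBall).2
      (integrableOn_const (measure_closedBall_lt_top).ne)
  set V := ∫ x, ind x
  have hV0 : 0 ≤ V := integral_nonneg hind0
  -- a function with small derivatives, supported in a ball, has a small drift
  have small : ∀ᵐ r ∂(volume.restrict (Set.Icc 0 T)), ∀ (ψ : Space d → ℝ) (D : ℝ), 0 ≤ D →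
      (∀ x, |ψ x| ≤ D ∧ ‖fderiv ℝ ψ x‖ ≤ D) →
      (∀ x, R + ρ < ‖x‖ → ψ x = 0 ∧ fderiv ℝ ψ x = 0) →
      ∀ᵐ x, |driftOp c β r ψ x| ≤ C * (1 + (R + ρ)) * (D + D) * ind x := by
    filter_upwards [spaceTime_ae_slice hC] with r hr ψ D hD0 hψ hψR
    filter_upwards [hr] with x hx
    by_cases hxR : ‖x‖ ≤ R + ρ
    · rw [hind, Set.indicator_of_mem (mem_closedBall_zero_iff.2 hxR), mul_one]
      refine (hx ψ).trans ?_
      gcongr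
      exacts [(hψ x).2, (hψ x).1]
    · have := hψR x (not_le.1 hxR)
      rw [driftOp_eq, this.1, this.2]
      have := hind0 x
      simp only [zero_apply, mul_zero, add_zero, abs_zero]
      positivity
  have meas : ∀ᵐ r ∂(volume.restrict (Set.Icc 0 T)), ∀ ψ, IsTestFunction ψ →
      AEStronglyMeasurable (driftOp c β r ψ) volume := by
    have h1 : ∀ᵐ r ∂(volume.restrict (Set.Icc 0 T)), AEStronglyMeasurable (c r) volume :=
      hc.aestronglyMeasurable.prodMk_left
    have h2 : ∀ᵐ r ∂(volume.restrict (Set.Icc 0 T)), AEStronglyMeasurable (β r) volume :=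
      hβ.1.prodMk_left
    filter_upwards [h1, h2] with r h1 h2 ψ hψ
    have e : driftOp c β r ψ = fun x => fderiv ℝ ψ x (c r x) + β r x * ψ x :=
      funext fun x => driftOp_eq r ψ x
    rw [e]
    exact (aestronglyMeasurable_clm_apply
      (hψ.1.continuous_fderiv (by simp)).aestronglyMeasurable h1).add
      (h2.mul hψ.continuous.aestronglyMeasurable)
  -- The two entries serve the size and the Lipschitz bound; the last maximum with `0` is there
  -- because the sign of `M` is not assumed.
  refine ⟨max (M * (C * (1 + (R + ρ)) * (K + K) * V)) (M * (C * (1 + (R + ρ)) * (L + L) * V)) ⊔ 0,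
    le_max_right _ _, ?_⟩
  -- The exceptional null set of times is independent of `v`, `z` and `z'`; this permits a function
  -- and a translation that depend on `r`.
  filter_upwards [small, meas] with r hr hm v hv z z' hz hz'
  have far : ∀ z : Space d, ‖z‖ ≤ ρ → ∀ x, R + ρ < ‖x‖ → R < ‖x + z‖ := fun z hz x hx => by
    have : ‖x‖ ≤ ‖x + z‖ + ‖z‖ := by simpa using norm_sub_le (x + z) z
    linarith
  have hfd : ∀ z x : Space d, fderiv ℝ (fun y => φ (y + z)) x = fderiv ℝ φ (x + z) := fun z x => by
    rw [fderiv_comp_add_right]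
  have b1 : ∀ z : Space d, ‖z‖ ≤ ρ →
      ∀ᵐ x, |driftOp c β r (fun x => φ (x + z)) x| ≤ C * (1 + (R + ρ)) * (K + K) * ind x :=
    fun z hz => hr _ K hK0 (fun x => ⟨hK1 _, by rw [hfd]; exact hK2 _⟩) fun x hx => by
      rw [hfd]
      exact hR _ (far z hz x hx)
  have int : ∀ z : Space d, ‖z‖ ≤ ρ → Integrable (driftOp c β r fun x => φ (x + z)) := fun z hz =>
    (iV.const_mul _).mono' (hm _ (hφ.translate z)) (b1 z hz)
  have fin : ∀ (f : Space d → ℝ) (B : ℝ), Integrable f → (∀ᵐ x, |f x| ≤ B * ind x) →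
      |pairing v f| ≤ M * (B * V) := fun f B hf hB => by
    refine (hv.abs_pairing_le hf).trans (mul_le_mul_of_nonneg_left ?_ hv.nonneg)
    rw [← integral_const_mul]
    exact integral_mono_ae hf.abs (iV.const_mul B) hB
  refine ⟨(fin _ _ (int z hz) (b1 z hz)).trans ((le_max_left _ _).trans (le_max_left _ _)), ?_⟩
  have e : pairing v (driftOp c β r fun x => φ (x + z))
      - pairing v (driftOp c β r fun x => φ (x + z'))
      = pairing v (driftOp c β r ((fun x => φ (x + z)) - fun x => φ (x + z'))) := by
    rw [pairing_sub_right hv.measurable.aestronglyMeasurable (ae_of_all _ hv.bound) (int z hz)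
      (int z' hz')]
    simp only [driftOp_sub (hφ.translate z) (hφ.translate z')]
    rfl
  have hn : ∀ x : Space d, x + z - (x + z') = z - z' := fun x => by abel
  have i3 : Integrable (driftOp c β r ((fun x => φ (x + z)) - fun x => φ (x + z'))) := by
    refine ((int z hz).sub (int z' hz')).congr (ae_of_all _ fun x => ?_)
    exact driftOp_sub (hφ.translate z) (hφ.translate z') r x
  have hD : ∀ x : Space d, fderiv ℝ ((fun x => φ (x + z)) - fun x => φ (x + z')) x
      = fderiv ℝ φ (x + z) - fderiv ℝ φ (x + z') := fun x => by
    rw [fderiv_sub ((hφ.translate z).1.differentiable (by simp) x)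
      ((hφ.translate z').1.differentiable (by simp) x), hfd, hfd]
  have b3 := fin _ (C * (1 + (R + ρ)) * (L * ‖z - z'‖ + L * ‖z - z'‖)) i3
    (hr _ (L * ‖z - z'‖) (by positivity)
      (fun x => ⟨by simpa only [hn, Pi.sub_apply] using (hL (x + z) (x + z')).1, by
        rw [hD]; simpa only [hn] using (hL (x + z) (x + z')).2⟩)
      fun x hx => by
        rw [hD, (hR _ (far z hz x hx)).2, (hR _ (far z' hz' x hx)).2, sub_zero]
        exact ⟨by simp [(hR _ (far z hz x hx)).1, (hR _ (far z' hz' x hx)).1], rfl⟩)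
  rw [e]
  refine b3.trans (le_trans (le_of_eq ?_) (mul_le_mul_of_nonneg_right
    ((le_max_right _ _).trans (le_max_left _ _)) (norm_nonneg _)))
  ring

end DriftShift

/-! ### Hölder bounds -/

section HolderBounds

variable {F : Type*} [NormedAddCommGroup F] {α T : ℝ}

theorem enorm_le_holderSeminorm_mul (f : ℝ → F) {s t : ℝ} (hs : s ∈ Set.Icc 0 T)
    (ht : t ∈ Set.Icc 0 T) :
    ‖f t - f s‖ₑ ≤ holderSeminorm α T f * ENNReal.ofReal (|t - s| ^ α) := by
  by_cases hst : s = t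
  · simp [hst]
  have h0 : 0 < |t - s| ^ α := Real.rpow_pos_of_pos (abs_pos.2 (sub_ne_zero.2 (Ne.symm hst))) _
  rw [← ENNReal.div_le_iff (by simpa using h0) ENNReal.ofReal_ne_top, holderSeminorm]
  exact le_iSup₂_of_le s hs (le_iSup₂_of_le t ht (le_iSup_of_le hst le_rfl))

theorem enorm_le_holderNorm₂_mul (f : ℝ → ℝ → F) {s t : ℝ} (hs : s ∈ Set.Icc 0 T)
    (ht : t ∈ Set.Icc 0 T) (hst : s ≠ t) :
    ‖f s t‖ₑ ≤ holderNorm₂ α T f * ENNReal.ofReal (|t - s| ^ α) := by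
  have h0 : 0 < |t - s| ^ α := Real.rpow_pos_of_pos (abs_pos.2 (sub_ne_zero.2 (Ne.symm hst))) _
  rw [← ENNReal.div_le_iff (by simpa using h0) ENNReal.ofReal_ne_top, holderNorm₂]
  exact le_iSup₂_of_le s hs (le_iSup₂_of_le t ht (le_iSup_of_le hst le_rfl))

theorem IsHolder.exists_bound {f : ℝ → F} (h : IsHolder α T f) :
    ∃ C : ℝ, 0 ≤ C ∧ ∀ s ∈ Set.Icc 0 T, ∀ t ∈ Set.Icc 0 T, ‖f t - f s‖ ≤ C * |t - s| ^ α := by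
  refine ⟨(holderSeminorm α T f).toReal, ENNReal.toReal_nonneg, fun s hs t ht => ?_⟩
  have := enorm_le_holderSeminorm_mul (α := α) f hs ht
  have h2 := ENNReal.toReal_mono (ENNReal.mul_ne_top h.2.ne ENNReal.ofReal_ne_top) this
  rwa [toReal_enorm, ENNReal.toReal_mul, ENNReal.toReal_ofReal (by positivity)] at h2

theorem enorm_div_ofReal_le {x : F} {C a : ℝ} (ha : 0 < a) (h : ‖x‖ ≤ C * a) :
    ‖x‖ₑ / ENNReal.ofReal a ≤ ENNReal.ofReal C := by
  rw [ENNReal.div_le_iff (by simpa using ha) ENNReal.ofReal_ne_top,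
    ← ENNReal.ofReal_mul' ha.le, ← ofReal_norm]
  exact ENNReal.ofReal_le_ofReal h

theorem isHolder_of_bound {f : ℝ → F} (hα : 0 < α) {C : ℝ}
    (h : ∀ s ∈ Set.Icc 0 T, ∀ t ∈ Set.Icc 0 T, ‖f t - f s‖ ≤ C * |t - s| ^ α) :
    IsHolder α T f := by
  constructor
  · intro s hs
    rw [ContinuousWithinAt, tendsto_iff_norm_sub_tendsto_zero]
    have hlim : Tendsto (fun t => C * |t - s| ^ α) (𝓝[Set.Icc 0 T] s) (𝓝 0) := by
      have hc : Continuous fun t : ℝ => C * |t - s| ^ α :=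
        continuous_const.mul ((by fun_prop : Continuous fun t : ℝ => |t - s|).rpow_const
          fun _ => Or.inr hα.le)
      have := hc.tendsto s
      rw [sub_self, abs_zero, Real.zero_rpow hα.ne', mul_zero] at this
      exact this.mono_left nhdsWithin_le_nhds
    refine squeeze_zero' (Eventually.of_forall fun _ => norm_nonneg _) ?_ hlim
    filter_upwards [self_mem_nhdsWithin] with t ht
    exact h s hs t ht
  · refine lt_of_le_of_lt ?_ (ENNReal.ofReal_lt_top (r := C))
    refine iSup₂_le fun s hs => iSup₂_le fun t ht => iSup_le fun hst => ?_
    exact enorm_div_ofReal_le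
      (Real.rpow_pos_of_pos (abs_pos.2 (sub_ne_zero.2 (Ne.symm hst))) _) (h s hs t ht)

theorem isHolder₂_of_bound {f : ℝ → ℝ → F} {C : ℝ}
    (hc : ContinuousOn (fun p : ℝ × ℝ => f p.1 p.2) (Set.Icc 0 T ×ˢ Set.Icc 0 T))
    (hd : ∀ t ∈ Set.Icc (0 : ℝ) T, f t t = 0)
    (h : ∀ s ∈ Set.Icc 0 T, ∀ t ∈ Set.Icc 0 T, ‖f s t‖ ≤ C * |t - s| ^ α) :
    IsHolder₂ α T f := by
  refine ⟨hc, hd, lt_of_le_of_lt ?_ (ENNReal.ofReal_lt_top (r := C))⟩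
  refine iSup₂_le fun s hs => iSup₂_le fun t ht => iSup_le fun hst => ?_
  exact enorm_div_ofReal_le
    (Real.rpow_pos_of_pos (abs_pos.2 (sub_ne_zero.2 (Ne.symm hst))) _) (h s hs t ht)

/-- On a bounded time interval a higher power of the increment is traded for a lower one at the
price of a power of `T`. -/
theorem rpow_le_const_mul_rpow {a p q : ℝ} (ha : 0 ≤ a) (haT : a ≤ T) (hp : 0 < p) (hpq : p ≤ q) :
    a ^ q ≤ T ^ (q - p) * a ^ p := by
  rcases ha.eq_or_lt with rfl | ha'
  · rw [Real.zero_rpow hp.ne', Real.zero_rpow (hp.trans_le hpq).ne', mul_zero]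
  · have e : a ^ q = a ^ (q - p) * a ^ p := by
      rw [← Real.rpow_add ha', sub_add_cancel]
    rw [e]
    exact mul_le_mul_of_nonneg_right (Real.rpow_le_rpow ha haT (by linarith)) (by positivity)

end HolderBounds

/-! ### Geometric rough paths -/

section Geometric

variable {d : ℕ} {T γ : ℝ} {X : ℝ → Space d} {XX : ℝ → ℝ → Fin d → Fin d → ℝ}

/-- This is the product rule for the centred components, integrated from `s` to `t`; the identity
then passes to limits in the rough path distance. -/
theorem naturalLift_add_swap (hT : 0 < T) {Y : ℝ → Space d} (hY : ContDiffOn ℝ 1 Y (Set.Icc 0 T))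
    {s t : ℝ} (hs : s ∈ Set.Icc 0 T) (ht : t ∈ Set.Icc 0 T) (i j : Fin d) :
    naturalLift T Y s t i j + naturalLift T Y s t j i = (Y t i - Y s i) * (Y t j - Y s j) := by
  have hsub : Set.uIcc s t ⊆ Set.Icc 0 T := Set.uIcc_subset_Icc hs ht
  have hd : ∀ k : Fin d, ∀ r ∈ Set.uIcc s t, HasDerivWithinAt (fun r => Y r k - Y s k)
      (derivWithin Y (Set.Icc 0 T) r k) (Set.uIcc s t) r := fun k r hr => by
    have h1 : HasDerivWithinAt Y (derivWithin Y (Set.Icc 0 T) r) (Set.Icc 0 T) r :=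
      (hY.differentiableOn (by simp) r (hsub hr)).hasDerivWithinAt
    have h2 := (EuclideanSpace.proj (𝕜 := ℝ) k).hasFDerivAt.comp_hasDerivWithinAt r (h1.mono hsub)
    exact h2.sub_const (Y s k)
  have hcont : ∀ k : Fin d, IntervalIntegrable (fun r => derivWithin Y (Set.Icc 0 T) r k)
      volume s t := fun k => by
    refine ContinuousOn.intervalIntegrable ?_
    have h1 := (hY.continuousOn_derivWithin (uniqueDiffOn_Icc hT) le_rfl).mono hsub
    exact (EuclideanSpace.proj (𝕜 := ℝ) k).continuous.comp_continuousOn h1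
  have hYc : ∀ k : Fin d, ContinuousOn (fun r => Y r k - Y s k) (Set.uIcc s t) := fun k r hr =>
    (hd k r hr).continuousWithinAt
  have key := intervalIntegral.integral_deriv_mul_eq_sub_of_hasDerivWithinAt (hd i) (hd j)
    (hcont i) (hcont j)
  rw [sub_self, zero_mul, sub_zero] at key
  rw [naturalLift, naturalLift, ← intervalIntegral.integral_add
    ((hcont j).continuousOn_mul (hYc i)) ((hcont i).continuousOn_mul (hYc j)), ← key]
  congr 1; funext r
  ring

/-- The symmetric part of the second level of a geometric rough path. -/
theorem IsGeometricRoughPath.add_swap (hT : 0 < T) (hX : IsGeometricRoughPath γ T X XX) {s t : ℝ}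
    (hs : s ∈ Set.Icc 0 T) (ht : t ∈ Set.Icc 0 T) (i j : Fin d) :
    XX s t i j + XX s t j i = (X t i - X s i) * (X t j - X s j) := by
  -- The diagonal is separate because `holderNorm₂` does not see it.
  by_cases hst : s = t
  · subst hst
    rw [hX.isRoughPath.holder₂.diag s hs]
    simp
  obtain ⟨Y, hY, hlim⟩ := hX.approx
  have lim1 : Tendsto (fun n => holderSeminorm γ T (fun t => X t - Y n t)) atTop (𝓝 0) :=
    tendsto_of_tendsto_of_tendsto_of_le_of_le tendsto_const_nhds hlim (fun _ => zero_le)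
      fun n => le_add_self.trans le_self_add
  have lim2 : Tendsto (fun n => holderNorm₂ (2 * γ) T
      (fun s t => XX s t - naturalLift T (Y n) s t)) atTop (𝓝 0) :=
    tendsto_of_tendsto_of_tendsto_of_le_of_le tendsto_const_nhds hlim (fun _ => zero_le)
      fun n => le_add_self
  have inc : Tendsto (fun n => Y n t - Y n s) atTop (𝓝 (X t - X s)) := by
    rw [tendsto_iff_edist_tendsto_0]
    have h0 := ENNReal.Tendsto.mul_const (b := ENNReal.ofReal (|t - s| ^ γ)) lim1
      (Or.inr ENNReal.ofReal_ne_top)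
    rw [zero_mul] at h0
    refine tendsto_of_tendsto_of_tendsto_of_le_of_le tendsto_const_nhds h0 (fun _ => zero_le)
      fun n => ?_
    rw [edist_comm, edist_eq_enorm_sub]
    refine le_trans (le_of_eq ?_)
      (enorm_le_holderSeminorm_mul (α := γ) (fun t => X t - Y n t) hs ht)
    congr 1
    abel
  have lev : Tendsto (fun n => naturalLift T (Y n) s t) atTop (𝓝 (XX s t)) := by
    rw [tendsto_iff_edist_tendsto_0]
    have h0 := ENNReal.Tendsto.mul_const (b := ENNReal.ofReal (|t - s| ^ (2 * γ))) lim2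
      (Or.inr ENNReal.ofReal_ne_top)
    rw [zero_mul] at h0
    refine tendsto_of_tendsto_of_tendsto_of_le_of_le tendsto_const_nhds h0 (fun _ => zero_le)
      fun n => ?_
    rw [edist_comm, edist_eq_enorm_sub]
    exact enorm_le_holderNorm₂_mul (α := 2 * γ)
      (fun s t => XX s t - naturalLift T (Y n) s t) hs ht hst
  have lev' : ∀ i j, Tendsto (fun n => naturalLift T (Y n) s t i j) atTop (𝓝 (XX s t i j)) :=
    fun i j => tendsto_pi_nhds.1 (tendsto_pi_nhds.1 lev i) j
  have inc' : ∀ i, Tendsto (fun n => Y n t i - Y n s i) atTop (𝓝 (X t i - X s i)) := fun i =>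
    ((EuclideanSpace.proj (𝕜 := ℝ) i).continuous.tendsto _).comp inc
  refine tendsto_nhds_unique ((lev' i j).add (lev' j i)) ?_
  refine ((inc' i).mul (inc' j)).congr fun n => ?_
  rw [naturalLift_add_swap hT (hY n) hs ht]

end Geometric

/-! ### Increments of the solution along a moving frame -/

section Increments

variable {d : ℕ} {T γ L ρ M : ℝ} {c : ℝ → Space d → Space d} {β : ℝ → Space d → ℝ}
  {u₀ : Space d → ℝ} {v : ℝ → Space d → ℝ} {Z : ℝ → Space d}

/-- `v` is a family of functions bounded by `M` solving the transport equation with the field `c`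
of divergence `β` in integrated form. -/
structure IsTransportSolution (T M : ℝ) (c : ℝ → Space d → Space d) (β : ℝ → Space d → ℝ)
    (u₀ : Space d → ℝ) (v : ℝ → Space d → ℝ) : Prop where
  bounded : ∀ t, IsBoundedBy M (v t)
  integrable : ∀ φ, IsTestFunction φ →
    IntegrableOn (fun s => pairing (v s) (driftOp c β s φ)) (Set.Icc 0 T)
  equation : ∀ φ, IsTestFunction φ → ∀ t ∈ Set.Icc 0 T, pairing (v t) φ
    = pairing u₀ φ + ∫ s in (0 : ℝ)..t, pairing (v s) (driftOp c β s φ)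

/-- `Z` is a path in the ball of radius `ρ`, Hölder continuous of exponent `γ` and constant `L`. -/
structure IsFrame (γ T L ρ : ℝ) (Z : ℝ → Space d) : Prop where
  bound : ∀ t ∈ Set.Icc 0 T, ‖Z t‖ ≤ ρ
  holder : ∀ s ∈ Set.Icc 0 T, ∀ t ∈ Set.Icc 0 T, ‖Z t - Z s‖ ≤ L * |t - s| ^ γ

theorem intervalIntegrable_of_integrableOn_Icc {f : ℝ → ℝ} (hf : IntegrableOn f (Set.Icc 0 T))
    {s t : ℝ} (hs : s ∈ Set.Icc 0 T) (ht : t ∈ Set.Icc 0 T) : IntervalIntegrable f volume s t :=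
  (hf.mono_set (Set.uIcc_subset_Icc hs ht)).intervalIntegrable

/-- No order is imposed on `s` and `t`, as the Hölder bounds are needed for both. -/
theorem IsTransportSolution.sub_eq_integral (h : IsTransportSolution T M c β u₀ v)
    {φ : Space d → ℝ} (hφ : IsTestFunction φ) {s t : ℝ} (hs : s ∈ Set.Icc 0 T)
    (ht : t ∈ Set.Icc 0 T) : pairing (v t) φ - pairing (v s) φ
      = ∫ r in s..t, pairing (v r) (driftOp c β r φ) := by
  have h0 : (0 : ℝ) ∈ Set.Icc 0 T := ⟨le_rfl, ht.1.trans ht.2⟩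
  rw [h.equation φ hφ t ht, h.equation φ hφ s hs, add_sub_add_left_eq_sub,
    intervalIntegral.integral_interval_sub_left
      (intervalIntegrable_of_integrableOn_Icc (h.integrable φ hφ) h0 ht)
      (intervalIntegrable_of_integrableOn_Icc (h.integrable φ hφ) h0 hs)]

/-- The contribution of the drift to the increments in a moving frame. -/
theorem IsTransportSolution.exists_time_bound (h : IsTransportSolution T M c β u₀ v)
    (hc : IsLinftyLin T c)
    (hβ : MemLp (fun p : ℝ × Space d => β p.1 p.2) ⊤ (spaceTime d T)) (hZ : IsFrame γ T L ρ Z)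
    (hγ : 0 < γ) (hρ : 0 ≤ ρ) (hL : 0 ≤ L) {φ : Space d → ℝ} (hφ : IsTestFunction φ)
    (hD : IntegrableOn (fun r => pairing (v r) (driftOp c β r fun x => φ (x + Z r)))
      (Set.Icc 0 T)) :
    ∃ C : ℝ, 0 ≤ C ∧ ∀ s ∈ Set.Icc 0 T, ∀ t ∈ Set.Icc 0 T,
      |shiftPairing (v t) φ (Z t) - shiftPairing (v s) φ (Z t)| ≤ C * |t - s| ∧
      |shiftPairing (v t) φ (Z t) - shiftPairing (v s) φ (Z t)
        - ∫ r in s..t, pairing (v r) (driftOp c β r fun x => φ (x + Z r))|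
        ≤ C * L * |t - s| ^ γ * |t - s| := by
  obtain ⟨C, hC0, hC⟩ := exists_drift_shift_bound hc hβ hφ M ρ hρ
  rw [ae_restrict_iff' measurableSet_Icc] at hC
  refine ⟨C, hC0, fun s hs t ht => ?_⟩
  have hsub : Set.uIoc s t ⊆ Set.Icc 0 T := Set.uIoc_subset_uIcc.trans (Set.uIcc_subset_Icc hs ht)
  have htest := hφ.translate (Z t)
  have e := h.sub_eq_integral htest hs ht
  rw [shiftPairing, shiftPairing, e]
  constructor
  · refine (Real.norm_eq_abs _).ge.trans
      (intervalIntegral.norm_integral_le_of_norm_le_const_ae ?_)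
    filter_upwards [hC] with r hr hmem
    exact (hr (hsub hmem) (v r) (h.bounded r) (Z t) (Z t) (hZ.bound t ht) (hZ.bound t ht)).1
  -- The test function has been frozen at the frame position `Z t`; returning to the running
  -- position `Z r` costs `‖Z t - Z r‖`, integrated over the interval.
  · rw [← intervalIntegral.integral_sub
      (intervalIntegrable_of_integrableOn_Icc (h.integrable _ htest) hs ht)
      (intervalIntegrable_of_integrableOn_Icc hD hs ht)]
    refine (Real.norm_eq_abs _).ge.trans
      (intervalIntegral.norm_integral_le_of_norm_le_const_ae ?_)
    filter_upwards [hC] with r hr hmem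
    have hrT := hsub hmem
    refine ((hr hrT (v r) (h.bounded r) (Z t) (Z r) (hZ.bound t ht) (hZ.bound r hrT)).2).trans ?_
    rw [mul_assoc]
    refine mul_le_mul_of_nonneg_left ((hZ.holder r hrT t ht).trans ?_) hC0
    refine mul_le_mul_of_nonneg_left (Real.rpow_le_rpow (abs_nonneg _) ?_ hγ.le) hL
    exact Set.abs_sub_right_of_mem_uIcc (Set.uIoc_subset_uIcc hmem)

/-- Expansion of the increments of `t ↦ v_t(φ(· + Z_t))` to the orders `γ`, `2γ` and `3γ`. -/
theorem IsTransportSolution.exists_increment_bounds (h : IsTransportSolution T M c β u₀ v)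
    (hc : IsLinftyLin T c)
    (hβ : MemLp (fun p : ℝ × Space d => β p.1 p.2) ⊤ (spaceTime d T)) (hZ : IsFrame γ T L ρ Z)
    (hT : 0 < T) (hγ : 0 < γ) (hγ' : γ ≤ 1 / 2) (hρ : 0 ≤ ρ) (hL : 0 ≤ L) {φ : Space d → ℝ}
    (hφ : IsTestFunction φ)
    (hD : IntegrableOn (fun r => pairing (v r) (driftOp c β r fun x => φ (x + Z r)))
      (Set.Icc 0 T)) :
    ∃ C : ℝ, 0 ≤ C ∧ ∀ s ∈ Set.Icc 0 T, ∀ t ∈ Set.Icc 0 T,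
      |shiftPairing (v t) φ (Z t) - shiftPairing (v s) φ (Z s)| ≤ C * |t - s| ^ γ ∧
      |shiftPairing (v t) φ (Z t) - shiftPairing (v s) φ (Z s)
        - ∑ i, (Z t - Z s) i * shiftPairing (v s) (partialDeriv i φ) (Z s)|
        ≤ C * |t - s| ^ (2 * γ) ∧
      |shiftPairing (v t) φ (Z t) - shiftPairing (v s) φ (Z s)
        - (∫ r in s..t, pairing (v r) (driftOp c β r fun x => φ (x + Z r)))
        - (∑ i, (Z t - Z s) i * shiftPairing (v s) (partialDeriv i φ) (Z s))
        - 1 / 2 * ∑ i, (Z t - Z s) i * ∑ j, (Z t - Z s) j *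
            shiftPairing (v s) (partialDeriv j (partialDeriv i φ)) (Z s)|
        ≤ C * |t - s| ^ (3 * γ) := by
  obtain ⟨C, hC0, hC⟩ := h.exists_time_bound hc hβ hZ hγ hρ hL hφ hD
  obtain ⟨C₁, hC₁⟩ := exists_taylor_one M hφ
  obtain ⟨C₂, hC₂⟩ := exists_taylor_two M hφ
  obtain ⟨C₃, hC₃⟩ := exists_taylor_three M hφ
  -- Each constant adds a drift part, whose order `1` or `1 + γ` is lowered by a power of `T`, to a
  -- Taylor part in `Z t - Z s`. The condition `γ ≤ 1 / 2` gives both `2 * γ ≤ 1` and `3 * γ ≤ 1 +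
  -- γ`.
  set K₁ := C * T ^ (1 - γ) + |C₁| * L with hK₁
  set K₂ := C * T ^ (1 - 2 * γ) + |C₂| * L ^ 2 with hK₂
  set K₃ := C * L * T ^ (1 + γ - 3 * γ) + |C₃| * L ^ 3 with hK₃
  have n1 : 0 ≤ K₁ := by positivity
  have n2 : 0 ≤ K₂ := by positivity
  have n3 : 0 ≤ K₃ := by positivity
  refine ⟨K₁ + K₂ + K₃, by positivity, fun s hs t ht => ?_⟩
  obtain ⟨h1, h2⟩ := hC s hs t ht
  have hB := h.bounded s
  set a := |t - s| with ha
  have ha0 : 0 ≤ a := abs_nonneg _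
  have haT : a ≤ T := abs_le.2 ⟨by linarith [hs.2, ht.1], by linarith [hs.1, ht.2]⟩
  have hz := hZ.holder s hs t ht
  have hag : 0 ≤ a ^ γ := by positivity
  have ezt : Z s + (Z t - Z s) = Z t := by abel
  have t1 := hC₁ (v s) hB (Z s) (Z t - Z s)
  have t2 := hC₂ (v s) hB (Z s) (Z t - Z s)
  have t3 := hC₃ (v s) hB (Z s) (Z t - Z s)
  rw [ezt] at t1 t2 t3
  have pow2 : (a ^ γ) ^ 2 = a ^ (2 * γ) := by
    rw [← Real.rpow_natCast, ← Real.rpow_mul ha0, mul_comm]; norm_num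
  have pow3 : (a ^ γ) ^ 3 = a ^ (3 * γ) := by
    rw [← Real.rpow_natCast, ← Real.rpow_mul ha0, mul_comm]; norm_num
  have pow1 : a ^ γ * a = a ^ (1 + γ) := by
    rw [add_comm, Real.rpow_add' ha0 (by linarith), Real.rpow_one]
  have l1 : a ≤ T ^ (1 - γ) * a ^ γ := by
    simpa using rpow_le_const_mul_rpow ha0 haT hγ (show γ ≤ 1 by linarith)
  have l2 : a ≤ T ^ (1 - 2 * γ) * a ^ (2 * γ) := by
    simpa using rpow_le_const_mul_rpow ha0 haT (show 0 < 2 * γ by linarith)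
      (show 2 * γ ≤ 1 by linarith)
  have l3 : a ^ (1 + γ) ≤ T ^ (1 + γ - 3 * γ) * a ^ (3 * γ) :=
    rpow_le_const_mul_rpow ha0 haT (by linarith) (by linarith)
  have b1 : C₁ * ‖Z t - Z s‖ ≤ |C₁| * L * a ^ γ := by
    rw [mul_assoc]
    exact mul_le_mul (le_abs_self _) hz (norm_nonneg _) (abs_nonneg _)
  have b2 : C₂ * ‖Z t - Z s‖ ^ 2 ≤ |C₂| * L ^ 2 * a ^ (2 * γ) := by
    rw [mul_assoc, ← pow2, ← mul_pow]
    exact mul_le_mul (le_abs_self _) (pow_le_pow_left₀ (norm_nonneg _) hz 2) (by positivity)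
      (abs_nonneg _)
  have b3 : C₃ * ‖Z t - Z s‖ ^ 3 ≤ |C₃| * L ^ 3 * a ^ (3 * γ) := by
    rw [mul_assoc, ← pow3, ← mul_pow]
    exact mul_le_mul (le_abs_self _) (pow_le_pow_left₀ (norm_nonneg _) hz 3) (by positivity)
      (abs_nonneg _)
  refine ⟨?_, ?_, ?_⟩
  · have k : K₁ * a ^ γ ≤ (K₁ + K₂ + K₃) * a ^ γ :=
      mul_le_mul_of_nonneg_right (by linarith) hag
    refine le_trans ?_ k
    have e : shiftPairing (v t) φ (Z t) - shiftPairing (v s) φ (Z s)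
        = (shiftPairing (v t) φ (Z t) - shiftPairing (v s) φ (Z t))
          + (shiftPairing (v s) φ (Z t) - shiftPairing (v s) φ (Z s)) := by ring
    rw [e]
    refine (abs_add_le _ _).trans ((add_le_add h1 (t1.trans b1)).trans ?_)
    have := mul_le_mul_of_nonneg_left l1 hC0
    rw [hK₁, add_mul, mul_assoc C]
    exact add_le_add this le_rfl
  · have k : K₂ * a ^ (2 * γ) ≤ (K₁ + K₂ + K₃) * a ^ (2 * γ) :=
      mul_le_mul_of_nonneg_right (by linarith) (by positivity)
    refine le_trans ?_ k
    have e : shiftPairing (v t) φ (Z t) - shiftPairing (v s) φ (Z s)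
          - ∑ i, (Z t - Z s) i * shiftPairing (v s) (partialDeriv i φ) (Z s)
        = (shiftPairing (v t) φ (Z t) - shiftPairing (v s) φ (Z t))
          + (shiftPairing (v s) φ (Z t) - shiftPairing (v s) φ (Z s)
          - ∑ i, (Z t - Z s) i * shiftPairing (v s) (partialDeriv i φ) (Z s)) := by ring
    rw [e]
    refine (abs_add_le _ _).trans ((add_le_add h1 (t2.trans b2)).trans ?_)
    have := mul_le_mul_of_nonneg_left l2 hC0
    rw [hK₂, add_mul, mul_assoc C]
    exact add_le_add this le_rfl
  · have k : K₃ * a ^ (3 * γ) ≤ (K₁ + K₂ + K₃) * a ^ (3 * γ) :=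
      mul_le_mul_of_nonneg_right (by linarith) (by positivity)
    refine le_trans ?_ k
    have e : ∀ x y z I A B : ℝ, x - z - I - A - B = (x - y - I) + (y - z - A - B) :=
      fun _ _ _ _ _ _ => by ring
    rw [e _ (shiftPairing (v s) φ (Z t))]
    refine (abs_add_le _ _).trans ((add_le_add h2 (t3.trans b3)).trans ?_)
    have := mul_le_mul_of_nonneg_left l3 (show 0 ≤ C * L by positivity)
    rw [mul_assoc (C * L), pow1, hK₃, add_mul, mul_assoc (C * L) (T ^ _)]
    exact add_le_add this le_rfl

end Increments

/-! ### Convergence of the compensated Riemann sums -/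

section RiemannSums

variable {d : ℕ}

/-- Monotonicity is available only below the index `n`, so the upper bound is obtained by descending
from `n`. -/
theorem mem_Icc_of_partition {n : ℕ} {τ : ℕ → ℝ} {t : ℝ} (h0 : τ 0 = 0) (hn : τ n = t)
    (hmono : ∀ k < n, τ k ≤ τ (k + 1)) : ∀ k ≤ n, τ k ∈ Set.Icc 0 t := by
  have lower : ∀ k ≤ n, 0 ≤ τ k := by
    intro k
    induction k with
    | zero => intro _; rw [h0]
    | succ k ih => intro hk; exact (ih (by omega)).trans (hmono k (by omega))
  have upper : ∀ k ≤ n, τ (n - k) ≤ t := by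
    intro k
    induction k with
    | zero => intro _; rw [Nat.sub_zero, hn]
    | succ k ih =>
      intro hk
      refine (hmono (n - (k + 1)) (by omega)).trans ?_
      rw [show n - (k + 1) + 1 = n - k by omega]
      exact ih (by omega)
  intro k hk
  refine ⟨lower k hk, ?_⟩
  have := upper (n - k) (by omega)
  rwa [show n - (n - k) = k by omega] at this

/-- If the increments of `G` are given by the germ up to an error of order `p > 1`, then the
Riemann sums of the germ converge to the increment of `G`. -/
theorem hasRoughIntegral_of_germ {X : ℝ → Space d} {XX : ℝ → ℝ → Fin d → Fin d → ℝ}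
    {a : ℝ → Space d} {a' : ℝ → Fin d → Space d} {G : ℝ → ℝ} {C p t : ℝ} (hC : 0 ≤ C) (hp : 1 < p)
    (ht : 0 ≤ t)
    (h : ∀ r s, 0 ≤ r → r ≤ s → s ≤ t →
      |(∑ i, a r i * (X s i - X r i)) + (∑ i, ∑ j, a' r i j * XX r s j i) - (G s - G r)|
        ≤ C * (s - r) ^ p) :
    HasRoughIntegral X XX a a' 0 t (G t - G 0) := by
  intro ε hε
  -- A mesh below `q ^ (1 / (p - 1))` makes each error at most `C * q` times the length of its
  -- interval; these sum to at most `C * q * t < ε`.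
  set q := ε / (C * t + 1) with hq
  have hq0 : 0 < q := by positivity
  refine ⟨q ^ (1 / (p - 1)), by positivity, fun n τ h0 hn hτ => ?_⟩
  have hmem := mem_Icc_of_partition h0 hn fun k hk => (hτ k hk).1
  have e : roughSum X XX a a' n τ - (G t - G 0)
      = ∑ k ∈ Finset.range n, ((∑ i, a (τ k) i * (X (τ (k + 1)) i - X (τ k) i))
        + (∑ i, ∑ j, a' (τ k) i j * XX (τ k) (τ (k + 1)) j i) - (G (τ (k + 1)) - G (τ k))) := by
    rw [Finset.sum_sub_distrib, Finset.sum_range_sub (fun k => G (τ k)), h0, hn, roughSum]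
  have hk : ∀ k ∈ Finset.range n, |(∑ i, a (τ k) i * (X (τ (k + 1)) i - X (τ k) i))
        + (∑ i, ∑ j, a' (τ k) i j * XX (τ k) (τ (k + 1)) j i) - (G (τ (k + 1)) - G (τ k))|
      ≤ C * q * (τ (k + 1) - τ k) := by
    intro k hk
    rw [Finset.mem_range] at hk
    refine (h _ _ (hmem k hk.le).1 (hτ k hk).1 (hmem (k + 1) hk).2).trans ?_
    rw [mul_assoc]
    refine mul_le_mul_of_nonneg_left ?_ hC
    have hΔ : 0 ≤ τ (k + 1) - τ k := sub_nonneg.2 (hτ k hk).1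
    have e1 : (τ (k + 1) - τ k) ^ p = (τ (k + 1) - τ k) ^ (p - 1) * (τ (k + 1) - τ k) := by
      rw [← Real.rpow_add_one' hΔ (by linarith), sub_add_cancel]
    rw [e1]
    refine mul_le_mul_of_nonneg_right ?_ hΔ
    refine (Real.rpow_le_rpow hΔ (hτ k hk).2.le (by linarith)).trans (le_of_eq ?_)
    rw [← Real.rpow_mul hq0.le, one_div_mul_cancel (by linarith), Real.rpow_one]
  rw [e]
  refine ((Finset.abs_sum_le_sum_abs _ _).trans (Finset.sum_le_sum hk)).trans_lt ?_
  rw [← Finset.mul_sum, Finset.sum_range_sub, h0, hn, sub_zero, hq]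
  have hpos : 0 < C * t + 1 := by positivity
  rw [mul_div_assoc', div_mul_eq_mul_div, div_lt_iff₀ hpos]
  nlinarith

/-- Contraction of a symmetric matrix with a matrix of given symmetric part. -/
theorem sum_sum_mul_eq_half {A XX : Fin d → Fin d → ℝ} {h : Fin d → ℝ}
    (hA : ∀ i j, A i j = A j i) (hXX : ∀ i j, XX i j + XX j i = h i * h j) :
    ∑ i, ∑ j, A i j * XX j i = 1 / 2 * ∑ i, h i * ∑ j, h j * A i j := by
  -- Because `A` is symmetric, transposing `XX` does not change the contraction, so averaging the
  -- two forms leaves only the prescribed symmetric part.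
  have e1 : ∑ i, ∑ j, A i j * XX j i = ∑ i, ∑ j, A i j * XX i j := by
    rw [Finset.sum_comm]
    exact Finset.sum_congr rfl fun i _ => Finset.sum_congr rfl fun j _ => by rw [hA]
  have e2 : ∑ i, h i * ∑ j, h j * A i j
      = ∑ i, ∑ j, A i j * XX j i + ∑ i, ∑ j, A i j * XX i j := by
    rw [← Finset.sum_add_distrib]
    refine Finset.sum_congr rfl fun i _ => ?_
    rw [← Finset.sum_add_distrib, Finset.mul_sum]
    refine Finset.sum_congr rfl fun j _ => ?_
    rw [← mul_add, add_comm, hXX]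
    ring
  rw [e2, ← e1]
  ring

end RiemannSums

/-! ### The moving frame -/

section Frame

variable {d : ℕ} {T ρ : ℝ} {b : ℝ → Space d → Space d} {β : ℝ → Space d → ℝ} {Z : ℝ → Space d}

/-- The translation of the space variable along a path preserves the measure. -/
theorem measurePreserving_shear (d : ℕ) (T : ℝ) {Z : ℝ → Space d} (hZ : Continuous Z) :
    MeasurePreserving (fun p : ℝ × Space d => (p.1, p.2 + Z p.1)) (spaceTime d T)
      (spaceTime d T) := by
  unfold spaceTime
  refine (MeasurePreserving.id _).skew_product (g := fun t x => x + Z t) ?_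
    (ae_of_all _ fun t => map_add_right_eq_self volume (Z t))
  exact (by fun_prop : Continuous fun p : ℝ × Space d => p.2 + Z p.1).measurable

theorem isLinftyLin_of_bound {c : ℝ → Space d → Space d} {C : ℝ}
    (hm : AEStronglyMeasurable (fun p : ℝ × Space d => c p.1 p.2) (spaceTime d T))
    (hC : ∀ᵐ p ∂spaceTime d T, ‖c p.1 p.2‖ ≤ C * (1 + ‖p.2‖)) : IsLinftyLin T c := by
  refine memLp_top_of_bound (C := C) ?_ ?_
  · have h1 : Continuous fun p : ℝ × Space d => (1 + ‖p.2‖)⁻¹ :=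
      Continuous.inv₀ (by fun_prop) fun p => by positivity
    exact h1.aestronglyMeasurable.smul hm
  · filter_upwards [hC] with p hp
    rw [norm_smul, norm_inv, Real.norm_of_nonneg (by positivity), inv_mul_le_iff₀ (by positivity)]
    linarith

theorem IsLinftyLin.shift (hb : IsLinftyLin T b) (hZ : Continuous Z)
    (hρ : ∀ t ∈ Set.Icc 0 T, ‖Z t‖ ≤ ρ) : IsLinftyLin T (fun t x => b t (x + Z t)) := by
  have hmp := measurePreserving_shear d T hZ
  obtain ⟨C, hC0, hC⟩ := hb.exists_bound
  refine isLinftyLin_of_bound (C := C * (1 + ρ))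
    (hb.aestronglyMeasurable.comp_measurePreserving hmp) ?_
  filter_upwards [hmp.quasiMeasurePreserving.ae hC, spaceTime_ae_mem d T] with p hp hpT
  refine hp.trans ?_
  rw [mul_assoc]
  refine mul_le_mul_of_nonneg_left ?_ hC0
  have h1 := norm_add_le p.2 (Z p.1)
  have h2 := hρ _ hpT
  have h3 : 0 ≤ ρ * ‖p.2‖ := mul_nonneg ((norm_nonneg _).trans h2) (norm_nonneg _)
  nlinarith

/-- The divergence is tested at each fixed time, where `Z t` is a constant vector: it suffices to
translate the test function back. -/
theorem IsWeakDiv.shift (h : IsWeakDiv T b β) (Z : ℝ → Space d) :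
    IsWeakDiv T (fun t x => b t (x + Z t)) (fun t x => β t (x + Z t)) := by
  filter_upwards [h] with t ht φ hφ
  have h1 := ht _ (hφ.translate (-Z t))
  simp only [partialDeriv_translate] at h1
  rw [← integral_add_right_eq_self (fun x => β t x * φ (x + -Z t)) (Z t),
    ← integral_add_right_eq_self (fun x => ∑ i, b t x i * partialDeriv i φ (x + -Z t)) (Z t)] at h1
  simpa using h1

theorem pairing_shift (v φ : Space d → ℝ) (z : Space d) :
    pairing (fun x => v (x - z)) φ = shiftPairing v φ z := by
  rw [pairing, ← integral_add_right_eq_self _ z]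
  simp [shiftPairing, pairing]

theorem driftOp_shift (t : ℝ) (φ : Space d → ℝ) (x : Space d) :
    driftOp b β t φ (x + Z t) = driftOp (fun t x => b t (x + Z t)) (fun t x => β t (x + Z t)) t
      (fun x => φ (x + Z t)) x := by
  simp only [driftOp, partialDeriv_translate]

end Frame

/-! ### Vector-valued Hölder paths from their components. -/

section Vectors

variable {d : ℕ} {α T : ℝ}

theorem norm_le_sum_abs (x : Space d) : ‖x‖ ≤ ∑ i, |x i| := by
  conv_lhs => rw [← (EuclideanSpace.basisFun (Fin d) ℝ).sum_repr x]
  refine (norm_sum_le _ _).trans (le_of_eq (Finset.sum_congr rfl fun i _ => ?_))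
  rw [norm_smul]
  simp

theorem isHolder_of_components (hα : 0 < α) {f : ℝ → Space d} {C : Fin d → ℝ}
    (h : ∀ i, ∀ s ∈ Set.Icc 0 T, ∀ t ∈ Set.Icc 0 T, |f t i - f s i| ≤ C i * |t - s| ^ α) :
    IsHolder α T f := by
  refine isHolder_of_bound hα (C := ∑ i, C i) fun s hs t ht => ?_
  refine (norm_le_sum_abs _).trans ?_
  rw [Finset.sum_mul]
  exact Finset.sum_le_sum fun i _ => h i s hs t ht

end Vectors

/-- The solution of the transport equation in the moving frame gives a weak controlled solution. -/
theorem exists_weakControlledSolution {d : ℕ} {T γ : ℝ} (hT : 0 < T) (hγ : 1 / 3 < γ)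
    (hγ' : γ ≤ 1 / 2) {b : ℝ → Space d → Space d} (hb : IsLinftyLin T b) {β : ℝ → Space d → ℝ}
    (hdiv : IsWeakDiv T b β)
    (hβ : MemLp (fun p : ℝ × Space d => β p.1 p.2) ⊤ (spaceTime d T)) {X : ℝ → Space d}
    {XX : ℝ → ℝ → Fin d → Fin d → ℝ} (hX : IsGeometricRoughPath γ T X XX) {u₀ : Space d → ℝ}
    (hu₀ : MemLp u₀ ⊤ volume) :
    ∃ u : ℝ → Space d → ℝ, IsWeakControlledSolution γ T X XX b β u₀ u := by
  have hγ0 : 0 < γ := by linarith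
  have h0T : (0 : ℝ) ∈ Set.Icc 0 T := ⟨le_rfl, hT.le⟩
  obtain ⟨L, hL0, hL⟩ := hX.isRoughPath.holder.exists_bound
  -- the frame
  set Z : ℝ → Space d := fun t => X (Set.projIcc 0 T hT.le t) - X 0 with hZdef
  have hZX : ∀ t ∈ Set.Icc 0 T, Z t = X t - X 0 := fun t ht => by
    simp only [hZdef, Set.projIcc_of_mem hT.le ht]
  -- `X` is known to be continuous only on `[0,T]`; precomposing with the projection makes the
  -- frame, and hence the shear of space-time, continuous everywhere.
  have hZc : Continuous Z :=
    (hX.isRoughPath.holder.1.comp_continuous (continuous_subtype_val.comp continuous_projIcc)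
      fun t => (Set.projIcc 0 T hT.le t).2).sub continuous_const
  have hZinc : ∀ s ∈ Set.Icc 0 T, ∀ t ∈ Set.Icc 0 T, Z t - Z s = X t - X s := fun s hs t ht => by
    rw [hZX s hs, hZX t ht]; abel
  have hZ : IsFrame γ T L (L * T ^ γ) Z := by
    refine ⟨fun t ht => ?_, fun s hs t ht => ?_⟩
    · rw [hZX t ht]
      refine (hL 0 h0T t ht).trans (mul_le_mul_of_nonneg_left ?_ hL0)
      rw [sub_zero, abs_of_nonneg ht.1]
      exact Real.rpow_le_rpow ht.1 ht.2 hγ0.le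
    · rw [hZinc s hs t ht]
      exact hL s hs t ht
  have hρ0 : 0 ≤ L * T ^ γ := by positivity
  have hZ0 : Z 0 = 0 := by rw [hZX 0 h0T, sub_self]
  -- the transport equation in the frame
  set c : ℝ → Space d → Space d := fun t x => b t (x + Z t) with hc_def
  set β' : ℝ → Space d → ℝ := fun t x => β t (x + Z t) with hβ_def
  have hc : IsLinftyLin T c := hb.shift hZc hZ.bound
  have hcdiv : IsWeakDiv T c β' := hdiv.shift Z
  have hβ' : MemLp (fun p : ℝ × Space d => β' p.1 p.2) ⊤ (spaceTime d T) :=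
    hβ.comp_measurePreserving (measurePreserving_shear d T hZc)
  obtain ⟨M, v, hvm, hvt, hvM, hv⟩ := exists_transport_solution hT hc hcdiv hβ' hu₀
  have hsol : IsTransportSolution T M c β' u₀ v :=
    ⟨fun t => ⟨hvt t, hvM t⟩, fun φ hφ => (hv φ hφ).1, fun φ hφ => (hv φ hφ).2⟩
  set u : ℝ → Space d → ℝ := fun t x => v t (x - Z t) with hu_def
  have hu : ∀ t φ, pairing (u t) φ = shiftPairing (v t) φ (Z t) := fun t φ =>
    pairing_shift (v t) φ (Z t)
  have hum : AEStronglyMeasurable (fun p : ℝ × Space d => u p.1 p.2) (spaceTime d T) := by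
    have := hvm.comp_measurePreserving (measurePreserving_shear d T hZc.neg)
    refine this.congr (ae_of_all _ fun p => ?_)
    simp [hu_def, sub_eq_add_neg]
  have huM : ∀ t x, |u t x| ≤ M := fun t x => hvM _ _
  have hdrift : ∀ r φ, pairing (v r) (driftOp c β' r fun x => φ (x + Z r))
      = pairing (u r) (driftOp b β r φ) := fun r φ => by
    rw [hu, shiftPairing]
    congr 1
    funext x
    rw [driftOp_shift]
  have hD : ∀ φ, IsTestFunction φ → IntegrableOn
      (fun r => pairing (v r) (driftOp c β' r fun x => φ (x + Z r))) (Set.Icc 0 T) := by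
    intro φ hφ
    simp only [hdrift]
    exact (integrable_bounded_mul hum (ae_of_all _ fun p => huM _ _)
      (integrable_driftOp hb hβ hφ)).integral_prod_left
  have bounds : ∀ φ, IsTestFunction φ → _ := fun φ hφ =>
    hsol.exists_increment_bounds hc hβ' hZ hT hγ0 hγ' hρ0 hL0 hφ (hD φ hφ)
  -- Hölder regularity of the pairings
  have hol : ∀ φ, IsTestFunction φ → IsHolder γ T (fun t => pairing (u t) φ) := fun φ hφ => by
    obtain ⟨C, -, hC⟩ := bounds φ hφ
    refine isHolder_of_bound hγ0 (C := C) fun s hs t ht => ?_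
    simp only [hu]
    exact (hC s hs t ht).1
  refine ⟨u, memLp_top_of_bound hum M (ae_of_all _ fun p => huM _ _), fun t _ => ?_,
    fun φ hφ => ⟨hol φ hφ, ?_, ?_⟩, fun φ hφ t ht => ?_⟩
  · exact memLp_top_of_bound ((hvt t).comp (measurable_id.sub_const _)).aestronglyMeasurable M
      (ae_of_all _ fun x => huM t x)
  · choose C _ hC using fun i => bounds _ (hφ.partialDeriv i)
    refine isHolder_of_components hγ0 (C := C) fun i s hs t ht => ?_
    simp only [pairingGrad, hu]
    exact (hC i s hs t ht).1
  · obtain ⟨C, -, hC⟩ := bounds φ hφ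
    refine isHolder₂_of_bound (C := C) ?_ (fun t _ => by simp) fun s hs t ht => ?_
    · have m1 : Set.MapsTo (Prod.fst : ℝ × ℝ → ℝ) (Set.Icc 0 T ×ˢ Set.Icc 0 T) (Set.Icc 0 T) :=
        fun p hp => hp.1
      have m2 : Set.MapsTo (Prod.snd : ℝ × ℝ → ℝ) (Set.Icc 0 T ×ˢ Set.Icc 0 T) (Set.Icc 0 T) :=
        fun p hp => hp.2
      have hXi : ∀ i : Fin d, ContinuousOn (fun t => X t i) (Set.Icc 0 T) := fun i =>
        (EuclideanSpace.proj (𝕜 := ℝ) i).continuous.comp_continuousOn hX.isRoughPath.holder.1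
      refine (((hol φ hφ).1.comp continuousOn_snd m2).sub
        ((hol φ hφ).1.comp continuousOn_fst m1)).sub (continuousOn_finsetSum _ fun i _ => ?_)
      exact ((hol _ (hφ.partialDeriv i)).1.comp continuousOn_fst m1).mul
        (((hXi i).comp continuousOn_snd m2).sub ((hXi i).comp continuousOn_fst m1))
    · refine le_trans (le_of_eq ?_) (hC s hs t ht).2.1
      rw [Real.norm_eq_abs, hZinc s hs t ht]
      simp only [pairingGrad, hu, PiLp.sub_apply]
      congr 2
      exact Finset.sum_congr rfl fun i _ => mul_comm _ _
  · obtain ⟨C, hC0, hC⟩ := bounds φ hφ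
    set D : ℝ → ℝ := fun r => pairing (v r) (driftOp c β' r fun x => φ (x + Z r)) with hD_def
    -- With the drift removed, the increments of `G` agree with the rough germ up to order `3 * γ`,
    -- so `G t - G 0` must be the rough integral.
    set G : ℝ → ℝ := fun t => pairing (u t) φ - ∫ r in (0 : ℝ)..t, D r with hG
    have hG0 : G 0 = pairing u₀ φ := by
      have e0 := hsol.equation φ hφ 0 h0T
      rw [intervalIntegral.integral_same, add_zero] at e0
      simp only [hG, intervalIntegral.integral_same, sub_zero]
      rw [hu, hZ0, ← e0]
      simp [shiftPairing]
    refine ⟨G t - G 0, ?_, ?_⟩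
    · refine hasRoughIntegral_of_germ hC0 (show 1 < 3 * γ by linarith) ht.1 fun r s hr hrs hst => ?_
      have hrT : r ∈ Set.Icc 0 T := ⟨hr, (hrs.trans hst).trans ht.2⟩
      have hsT : s ∈ Set.Icc 0 T := ⟨hr.trans hrs, hst.trans ht.2⟩
      have h3 := (hC r hrT s hsT).2.2
      rw [abs_of_nonneg (sub_nonneg.2 hrs)] at h3
      refine le_trans (le_of_eq ?_) h3
      have eint : ∫ x in r..s, D x = (∫ x in (0 : ℝ)..s, D x) - ∫ x in (0 : ℝ)..r, D x :=
        (intervalIntegral.integral_interval_sub_left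
          (intervalIntegrable_of_integrableOn_Icc (hD φ hφ) h0T hsT)
          (intervalIntegrable_of_integrableOn_Icc (hD φ hφ) h0T hrT)).symm
      -- This identifies the second-level term of the Riemann sum with the quadratic Taylor term.
      have hsym := sum_sum_mul_eq_half (XX := XX r s) (h := fun i => X s i - X r i)
        (A := fun i j => shiftPairing (v r) (partialDeriv j (partialDeriv i φ)) (Z r))
        (fun i j => by
          congr 1
          funext x
          exact partialDeriv_comm hφ i j x)
        fun i j => hX.add_swap hT hrT hsT i j
      rw [hZinc r hrT s hsT, eint]
      simp only [pairingGrad, hu, hG, PiLp.sub_apply, hsym]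
      rw [← abs_neg]
      congr 1
      have ecomm : ∑ i, shiftPairing (v r) (partialDeriv i φ) (Z r) * (X s i - X r i)
          = ∑ i, (X s i - X r i) * shiftPairing (v r) (partialDeriv i φ) (Z r) :=
        Finset.sum_congr rfl fun i _ => mul_comm _ _
      rw [ecomm]
      ring
    · rw [hG0]
      have e : ∫ s in (0 : ℝ)..t, pairing (u s)
          (fun x => (∑ i, b s x i * partialDeriv i φ x) + β s x * φ x)
          = ∫ r in (0 : ℝ)..t, D r := by
        congr 1
        funext r
        exact (hdrift r φ).symm
      rw [e]
      simp only [hG]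
      ring

end RoughTransport

theorem mainTheorem4 (d : ℕ) (hd : 1 ≤ d) (T : ℝ) (hT : 0 < T)
    (γ : ℝ) (hγ : 1 / 3 < γ) (hγ' : γ ≤ 1 / 2)
    (b : ℝ → EuclideanSpace ℝ (Fin d) → EuclideanSpace ℝ (Fin d))
    (hb : RoughTransport.IsLinftyLin T b)
    (β : ℝ → EuclideanSpace ℝ (Fin d) → ℝ)
    (hβ : RoughTransport.IsWeakDiv T b β)
    (hβ_bdd : MemLp (fun p : ℝ × EuclideanSpace ℝ (Fin d) => β p.1 p.2) ⊤
      (RoughTransport.spaceTime d T))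
    (X : ℝ → EuclideanSpace ℝ (Fin d)) (XX : ℝ → ℝ → Fin d → Fin d → ℝ)
    (hX : RoughTransport.IsGeometricRoughPath γ T X XX)
    (u₀ : EuclideanSpace ℝ (Fin d) → ℝ) (hu₀ : MemLp u₀ ⊤ volume) :
    ∃ u : ℝ → EuclideanSpace ℝ (Fin d) → ℝ,
      RoughTransport.IsWeakControlledSolution γ T X XX b β u₀ u :=
  RoughTransport.exists_weakControlledSolution hT hγ hγ' hb hβ hβ_bdd hX hu₀
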